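/- Let $d\ge 2$. Let $X=(X_n)_{n\ge 0}$ be a $\mathbb{Z}^d$-valued process with $X_0=0$, adapted to a filtration $(\mathcal{F}_n)_{n\ge0}$ on a probability space $(\Omega,\mathcal{F},\mathbb{P})$. Let $(\lambda_n)_{n\ge 0}$ be a sequence of positive reals, $\ell\in\mathbb{R}^d$ with $\|\ell\|=1$ (Euclidean norm), $A\subset\mathbb{Z}^d$ nonempty, and $K,h,r>0$. Write $D_n=\mathbb{E}[X_{n+1}-X_n\mid\mathcal{F}_n]$. We call $X$ a $\lambda_n$-GERW (generalized excited random walk) in direction $\ell$ with excitation set $A$ and constants $K,h,r$ if the following hold. 1. $\sup_{n\ge0}\|X_{n+1}-X_n\|<K$ on every realization. 2. For every $n$, almost surely: $D_n\cdot\ell\ge\lambda_n$ on the event that $X_k\ne X_n$ for all $k<n$ and $X_n\in A$; and $D_n=0$ on the complement of this event. 3. For every $n$, almost surely, $\mathbb{P}[(X_{n+1}-X_n)\cdot\ell>r\mid\mathcal{F}_n]\ge h$; and for every $n$ and every $\ell'\in\mathbb{R}^d$ with $\|\ell'\|=1$, almost surely on the event $\{D_n=0\}$, $\mathbb{P}[(X_{n+1}-X_n)\cdot\ell'>r\mid\mathcal{F}_n]\ge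 h$. Theorem. For all $d\ge2$ and $K,h,r>0$ there exists $\beta_0\in(0,1/6)$, depending only on $d,K,h,r$, such that the following holds. Let $X$ be a $\lambda_n$-GERW in direction $\ell$ with excitation set $A$ and constants $K,h,r$, where $A\supset\{x\in\mathbb{Z}^d: x\cdot\ell>0\}$. If for some integer $n_0\ge 0$, some $\lambda>0$ and some real $\beta<\beta_0$ we have $\lambda_n\ge\lambda(n_0+n)^{-\beta}$ for every $n\ge1$, then $$\mathbb{P}\Big(\lim_{n\to\infty}X_n\cdot\ell=\infty\Big)>0.$$ -/

import Mathlib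

open MeasureTheory ProbabilityTheory Filter

/-- The inclusion of the lattice `ℤ^d` into `ℝ^d` with its Euclidean norm. -/
noncomputable def latticePoint {d : ℕ} (x : Fin d → ℤ) : EuclideanSpace ℝ (Fin d) :=
  WithLp.toLp 2 (fun i => (x i : ℝ))

/-- The `n`-th increment `X_{n+1} - X_n` of a lattice process, as a random vector of `ℝ^d`. -/
noncomputable def increment {d : ℕ} {Ω : Type*} (X : ℕ → Ω → (Fin d → ℤ)) (n : ℕ) (ω : Ω) :
    EuclideanSpace ℝ (Fin d) :=
  latticePoint (X (n + 1) ω) - latticePoint (X n ω)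

/-- The drift `𝔼[X_{n+1} - X_n | ℱ_n]`, a random vector of `ℝ^d`. -/
noncomputable def drift {d : ℕ} {Ω : Type*} {mΩ : MeasurableSpace Ω} (P : Measure Ω)
    (ℱ : Filtration ℕ mΩ) (X : ℕ → Ω → (Fin d → ℤ)) (n : ℕ) :
    Ω → EuclideanSpace ℝ (Fin d) :=
  P[increment X n | ℱ n]

/-- The conditional probability `ℙ[(X_{n+1} - X_n) · v > r | ℱ_n]`. -/
noncomputable def condProbJump {d : ℕ} {Ω : Type*} {mΩ : MeasurableSpace Ω} (P : Measure Ω)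
    (ℱ : Filtration ℕ mΩ) (X : ℕ → Ω → (Fin d → ℤ))
    (r : ℝ) (v : EuclideanSpace ℝ (Fin d)) (n : ℕ) : Ω → ℝ :=
  P⟦{ω | r < inner ℝ (increment X n ω) v} | ℱ n⟧

/-- The part of the lattice in the open half-space `{x · ℓ > 0}`. -/
def positiveHalfSpace {d : ℕ} (ℓ : EuclideanSpace ℝ (Fin d)) : Set (Fin d → ℤ) :=
  {x | 0 < inner ℝ (latticePoint x) ℓ}

/-- `X` is a `lam n`-GERW (generalized excited random walk) in direction `ℓ` with excitation
set `A`, on the probability space `(Ω, P)` with filtration `ℱ`; `K` is the bound on the increments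
and `h`, `r` are the ellipticity constants. -/
structure IsGERW {d : ℕ} {Ω : Type*} {mΩ : MeasurableSpace Ω} (P : Measure Ω)
    (ℱ : Filtration ℕ mΩ)
    (lam : ℕ → ℝ) (ℓ : EuclideanSpace ℝ (Fin d)) (A : Set (Fin d → ℤ)) (K h r : ℝ)
    (X : ℕ → Ω → (Fin d → ℤ)) : Prop where
  lam_pos : ∀ n, 0 < lam n
  norm_direction : ‖ℓ‖ = 1
  nonempty_excitation : A.Nonempty
  K_pos : 0 < K
  h_pos : 0 < h
  r_pos : 0 < r
  /-- the process is adapted -/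
  adapted : ∀ n, Measurable[ℱ n] (X n)
  start : ∀ ω, X 0 ω = 0
  /-- bounded increments, on every realization (the squared norms of lattice vectors are
  integers, so a strict bound on all increments is a strict bound on their supremum) -/
  bounded : ∀ n ω, ‖increment X n ω‖ < K
  /-- drift at the first visit to a site of the excitation set -/
  drift_excited : ∀ n, ∀ᵐ ω ∂P, (∀ k < n, X k ω ≠ X n ω) → X n ω ∈ A →
    lam n ≤ inner ℝ (drift P ℱ X n ω) ℓ
  /-- no drift at visited sites and at sites outside the excitation set -/
  drift_zero : ∀ n, ∀ᵐ ω ∂P,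
    ((∃ k < n, X k ω = X n ω) ∨ ((∀ k < n, X k ω ≠ X n ω) ∧ X n ω ∉ A)) → drift P ℱ X n ω = 0
  /-- uniform ellipticity in direction `ℓ` -/
  elliptic_direction : ∀ n, ∀ᵐ ω ∂P, h ≤ condProbJump P ℱ X r ℓ n ω
  /-- uniform ellipticity in every direction on the event that the drift vanishes -/
  elliptic_zero_drift : ∀ n, ∀ v : EuclideanSpace ℝ (Fin d), ‖v‖ = 1 →
    ∀ᵐ ω ∂P, drift P ℱ X n ω = 0 → h ≤ condProbJump P ℱ X r v n ω

/-! The theorem is a contest between drift and fluctuation. Up to time `n`, the compensated sum of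
the increments in direction `ℓ` falls below `-n ^ (1/2 + ε)` only with stretched-exponentially small
probability (`measureReal_sum_le_sub_rpow_le`). While the walk stays in the half-space, the drift
collected is at least the number of new sites times a quantity of order `n ^ (-β)`. So it is enough
to know that, with probability `1 - O(n ^ (-γ))`, more than `n ^ (1/2 + α)` of the first `n` steps
start at new sites, for some `α > 0` depending only on `d, K, h, r` (`exists_occurrences_bound`).
Then `β₀ = α / 2` works with `ε = α / 4`.

The bound on new sites cannot use any information on the drift there, only that steps are bounded;
off the new sites the walk is centered and elliptic in every direction (`IsCenteredOff`). Fix a time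
`i` and follow the potential `g ^ p`, where `g = √(B + ‖Y_j - Y_i‖²)` and `p < 1` is close to `1`.
In dimension at least two, ellipticity gives variance orthogonal to the displacement, which pushes
`g` outwards; if `p` is close to `1` and `B` is large, this beats the concavity of the power. Hence
`g ^ p` is a submartingale at old sites, and it gains a fixed amount at each return to `Y_i`. At a
new site it may lose at most `K * g ^ (p - 1)`. New sites are distinct lattice points, so `m` of
them cannot all be close to `Y_i`, and the total loss is `O(m ^ (1 - η))` with `η = (1 - p) / (2 *
d)`. Stopped before the number of new sites exceeds `m ≥ √n`, the walk is at mean distance `O(m)`,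
so the final potential is `O(m ^ p)`. The expected number of returns to `Y_i` before stopping is
therefore `O(m ^ (1 - η))` (`sum_measureReal_return_le`).

If only `m` new sites were met in `n` steps, Cauchy–Schwarz for the local times would force at least
`n ^ 2 / (8 * m)` pairs of times at the same site, while the expected number of such pairs is `O(n *
m ^ (1 - η))`. Markov's inequality with `m = n ^ (1/2 + η/8)` gives the bound on new sites.

To conclude, condition on the event, of positive probability, that the first `k₀` steps all advance
by more than `r`. This gives an initial height twice the fluctuation allowed up to time `2 ^ κ`. For
`κ` large the failure probabilities at all later scales sum to less than one, and off these failures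
a deterministic induction (`tendsto_atTop_of_dyadic_bounds`) keeps the walk positive and drives it
to infinity. -/

/-! ### Second-order expansions of powers. -/

/-- Bernoulli's inequality for the complementary exponent `1 - p` bounds `(1 + z) ^ (1 - p)` from
above; since the two powers multiply to `1 + z`, this bounds the other one from below, with an error
proportional to `1 - p`. -/
theorem one_add_rpow_ge {p z : ℝ} (hp0 : 0 ≤ p) (hp1 : p ≤ 1) (hz : |z| ≤ 1 / 2) :
    1 + p * z - 2 * p * (1 - p) * z ^ 2 ≤ (1 + z) ^ p := by
  obtain ⟨hz1, hz2⟩ := abs_le.1 hz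
  have h0 : 0 < 1 + z := by linarith
  have hq : (1 + z) ^ (1 - p) ≤ 1 + (1 - p) * z :=
    rpow_one_add_le_one_add_mul_self (by linarith) (by linarith) (by linarith)
  have hqpos : 0 < (1 + z) ^ (1 - p) := Real.rpow_pos_of_pos h0 _
  have hmul : (1 + z) ^ p * (1 + z) ^ (1 - p) = 1 + z := by
    rw [← Real.rpow_add h0]; simp
  have hppos : 0 < (1 + z) ^ p := Real.rpow_pos_of_pos h0 _
  have hden : 0 < 1 + (1 - p) * z := lt_of_lt_of_le hqpos hq
  have h1 : 1 + z ≤ (1 + z) ^ p * (1 + (1 - p) * z) := by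
    calc 1 + z = (1 + z) ^ p * (1 + z) ^ (1 - p) := hmul.symm
      _ ≤ _ := mul_le_mul_of_nonneg_left hq hppos.le
  have hx : -(1 / 2) ≤ (1 - p) * z := by nlinarith
  have h2 : (1 + p * z - 2 * p * (1 - p) * z ^ 2) * (1 + (1 - p) * z) ≤ 1 + z := by
    have : 0 ≤ p * (1 - p) * z ^ 2 * (1 + 2 * ((1 - p) * z)) := by
      have := mul_nonneg hp0 (sub_nonneg.2 hp1)
      have := sq_nonneg z
      have : 0 ≤ 1 + 2 * ((1 - p) * z) := by linarith
      positivity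
    nlinarith
  exact le_of_mul_le_mul_right (h2.trans h1) hden

/-- With `D = g' - g`, the relation `2 * g * D = 2 * a + b - D ^ 2` gives `D = a / g` up to `K ^ 2 /
(2 * g)`; inserting this into `D ^ 2` gives the next order. In the application `a` is the inner
product of position and step, and `b` the squared length of the step. -/
theorem sub_ge_of_sq_eq {g g' a b K : ℝ} (hg : 0 < g) (hK : 0 ≤ K)
    (hΔ : |g' - g| ≤ K) (hs : g' ^ 2 = g ^ 2 + (2 * a + b)) (ha : |a| ≤ g * K)
    (hb0 : 0 ≤ b) (hbK : b ≤ K ^ 2) (hKg : K ≤ g) :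
    a / g + (b - a ^ 2 / g ^ 2) / (2 * g) - K ^ 3 / g ^ 2 ≤ g' - g := by
  set D := g' - g with hD
  have hrel : 2 * g * D = 2 * a + b - D ^ 2 := by rw [hD]; linarith [hs]
  have hD2 : D ^ 2 ≤ K ^ 2 := sq_le_sq' (abs_le.1 hΔ).1 (abs_le.1 hΔ).2
  set u := a / g with hu
  have hau : a = u * g := by rw [hu]; field_simp
  have huK : |u| ≤ K := by
    rw [hu, abs_div, abs_of_pos hg, div_le_iff₀ hg]; linarith
  have h1 : |D - u| ≤ K ^ 2 / (2 * g) := by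
    have : D - u = (b - D ^ 2) / (2 * g) := by
      rw [eq_div_iff (by positivity)]; rw [hau] at hrel; linarith
    rw [this, abs_div, abs_of_pos (by positivity : 0 < 2 * g)]
    gcongr
    rw [abs_le]; constructor <;> nlinarith [sq_nonneg D]
  set e := K ^ 2 / (2 * g) with he
  have he0 : 0 ≤ e := by positivity
  have heg : e * (2 * g) = K ^ 2 := by rw [he]; field_simp
  have heK : 2 * e ≤ K := by nlinarith
  have hDu : D ^ 2 ≤ u ^ 2 + 2 * K * e + e ^ 2 := by
    have : D ^ 2 = u ^ 2 + 2 * u * (D - u) + (D - u) ^ 2 := by ring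
    have h3 : (D - u) ^ 2 ≤ e ^ 2 := sq_le_sq' (abs_le.1 h1).1 (abs_le.1 h1).2
    have h4 : u * (D - u) ≤ K * e := by
      calc u * (D - u) ≤ |u * (D - u)| := le_abs_self _
        _ = |u| * |D - u| := abs_mul _ _
        _ ≤ K * e := mul_le_mul huK h1 (abs_nonneg _) hK
    linarith
  have hfin : D ^ 2 ≤ u ^ 2 + 2 * (K ^ 3 / g) := by
    have : K ^ 3 / g = 2 * K * e := by rw [he]; field_simp
    rw [this]; nlinarith
  have e1 : a ^ 2 / g ^ 2 = u ^ 2 := by rw [hu]; ring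
  have e2 : K ^ 3 / g ^ 2 = (2 * (K ^ 3 / g)) / (2 * g) := by field_simp
  have e3 : u = (2 * a) / (2 * g) := by rw [hu]; field_simp
  rw [e1, e2]
  nth_rewrite 1 [e3]
  rw [← add_div, ← sub_div, div_le_iff₀ (by positivity)]
  nlinarith

theorem rpow_sub_rpow_ge {p g g' a b K : ℝ} (hp0 : 0 ≤ p) (hp1 : p ≤ 1) (hg : 0 < g)
    (hK : 0 ≤ K) (hΔ : |g' - g| ≤ K) (hs : g' ^ 2 = g ^ 2 + (2 * a + b)) (ha : |a| ≤ g * K)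
    (hb0 : 0 ≤ b) (hbK : b ≤ K ^ 2) (hKg : 2 * K ≤ g) :
    p * g ^ (p - 2) * (a + (b - a ^ 2 / g ^ 2) / 2 - K ^ 3 / g - 2 * (1 - p) * K ^ 2)
      ≤ g' ^ p - g ^ p := by
  have h1 := sub_ge_of_sq_eq hg hK hΔ hs ha hb0 hbK (by linarith)
  set D := g' - g with hD
  have hz : |D / g| ≤ 1 / 2 := by
    rw [abs_div, abs_of_pos hg, div_le_iff₀ hg]; linarith
  have h2 := one_add_rpow_ge hp0 hp1 hz
  have hgD : g' = g * (1 + D / g) := by rw [hD]; field_simp; ring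
  have hpos : 0 ≤ 1 + D / g := by linarith [(abs_le.1 hz).1]
  have h3 : g' ^ p = g ^ p * (1 + D / g) ^ p := by
    nth_rewrite 1 [hgD]; rw [Real.mul_rpow hg.le hpos]
  have h4 : g ^ p = g ^ (p - 2) * g ^ 2 := by
    rw [← Real.rpow_natCast g 2, ← Real.rpow_add hg]; norm_num
  have hgp : 0 < g ^ (p - 2) := Real.rpow_pos_of_pos hg _
  have hD2 : D ^ 2 ≤ K ^ 2 := sq_le_sq' (abs_le.1 hΔ).1 (abs_le.1 hΔ).2
  have h5 : g ^ p * (p * (D / g) - 2 * p * (1 - p) * (D / g) ^ 2) ≤ g' ^ p - g ^ p := by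
    rw [h3]; nlinarith [Real.rpow_pos_of_pos hg p]
  refine le_trans ?_ h5
  have h6 : g ^ p * (p * (D / g) - 2 * p * (1 - p) * (D / g) ^ 2)
      = p * g ^ (p - 2) * (g * D - 2 * (1 - p) * D ^ 2) := by
    rw [h4]; field_simp
  rw [h6]
  refine mul_le_mul_of_nonneg_left ?_ (by positivity)
  have h7 : g * (a / g + (b - a ^ 2 / g ^ 2) / (2 * g) - K ^ 3 / g ^ 2)
      = a + (b - a ^ 2 / g ^ 2) / 2 - K ^ 3 / g := by
    field_simp
  have h8 := mul_le_mul_of_nonneg_left h1 hg.le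
  rw [h7] at h8
  have h9 : 2 * (1 - p) * D ^ 2 ≤ 2 * (1 - p) * K ^ 2 :=
    mul_le_mul_of_nonneg_left hD2 (by linarith)
  linarith

/-! ### The smoothed norm and its one-step increments. -/

section SmoothNorm

variable {E : Type*} [NormedAddCommGroup E]

/-- The smoothed norm `√(B + ‖y‖²)`. -/
noncomputable def smoothNorm (B : ℝ) (y : E) : ℝ := Real.sqrt (B + ‖y‖ ^ 2)

theorem smoothNorm_sq {B : ℝ} (hB : 0 ≤ B) (y : E) : smoothNorm B y ^ 2 = B + ‖y‖ ^ 2 :=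
  Real.sq_sqrt (by positivity)

theorem smoothNorm_nonneg (B : ℝ) (y : E) : 0 ≤ smoothNorm B y := Real.sqrt_nonneg _

theorem sqrt_le_smoothNorm (B : ℝ) (y : E) : Real.sqrt B ≤ smoothNorm B y :=
  Real.sqrt_le_sqrt (by nlinarith [norm_nonneg y])

theorem smoothNorm_pos {B : ℝ} (hB : 0 < B) (y : E) : 0 < smoothNorm B y :=
  Real.sqrt_pos.2 (by positivity)

theorem norm_le_smoothNorm {B : ℝ} (hB : 0 ≤ B) (y : E) : ‖y‖ ≤ smoothNorm B y :=
  Real.le_sqrt_of_sq_le (by linarith)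

theorem smoothNorm_zero (B : ℝ) : smoothNorm B (0 : E) = Real.sqrt B := by
  simp [smoothNorm]

variable [InnerProductSpace ℝ E]

theorem smoothNorm_add_sq {B : ℝ} (hB : 0 ≤ B) (y ξ : E) :
    smoothNorm B (y + ξ) ^ 2 = smoothNorm B y ^ 2 + (2 * inner ℝ y ξ + ‖ξ‖ ^ 2) := by
  rw [smoothNorm_sq hB, smoothNorm_sq hB, norm_add_sq_real]; ring

theorem smoothNorm_add_le {B : ℝ} (hB : 0 ≤ B) (y ξ : E) :
    smoothNorm B (y + ξ) ≤ smoothNorm B y + ‖ξ‖ := by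
  have h1 := smoothNorm_add_sq hB y ξ
  have h2 : inner ℝ y ξ ≤ ‖y‖ * ‖ξ‖ := real_inner_le_norm _ _
  have h3 := mul_le_mul_of_nonneg_right (norm_le_smoothNorm hB y) (norm_nonneg ξ)
  refine le_of_sq_le_sq ?_ (add_nonneg (smoothNorm_nonneg _ _) (norm_nonneg _))
  nlinarith

theorem abs_smoothNorm_add_sub_le {B : ℝ} (hB : 0 ≤ B) (y ξ : E) :
    |smoothNorm B (y + ξ) - smoothNorm B y| ≤ ‖ξ‖ := by
  have h1 := smoothNorm_add_le hB y ξ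
  have h2 := smoothNorm_add_le hB (y + ξ) (-ξ)
  rw [norm_neg, add_neg_cancel_right] at h2
  rw [abs_le]; constructor <;> linarith

theorem smoothNorm_add_sub_le {B : ℝ} (hB : 0 < B) (y ξ : E) :
    smoothNorm B (y + ξ) - smoothNorm B y
      ≤ (smoothNorm B y)⁻¹ * inner ℝ y ξ + ‖ξ‖ ^ 2 / (2 * Real.sqrt B) := by
  have h1 := smoothNorm_add_sq hB.le y ξ
  have hpos := smoothNorm_pos hB y
  have hsq : 0 < Real.sqrt B := Real.sqrt_pos.2 hB
  have hle := sqrt_le_smoothNorm B y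
  set g := smoothNorm B y
  set g' := smoothNorm B (y + ξ)
  have h2 : g' - g ≤ (2 * inner ℝ y ξ + ‖ξ‖ ^ 2) / (2 * g) := by
    rw [le_div_iff₀ (by positivity)]; nlinarith [sq_nonneg (g' - g)]
  have h3 : (2 * inner ℝ y ξ + ‖ξ‖ ^ 2) / (2 * g) = g⁻¹ * inner ℝ y ξ + ‖ξ‖ ^ 2 / (2 * g) := by
    field_simp
  have h4 : ‖ξ‖ ^ 2 / (2 * g) ≤ ‖ξ‖ ^ 2 / (2 * Real.sqrt B) := by gcongr
  linarith

/-- Since `y` is orthogonal to `v`, it only sees the part of `ξ` orthogonal to `v`, and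
Cauchy–Schwarz applies to that part. -/
theorem inner_sq_add_inner_sq_le {y v ξ : E} {g : ℝ} (hv : ‖v‖ = 1) (hyv : inner ℝ y v = 0)
    (hg : ‖y‖ ≤ g) : inner ℝ y ξ ^ 2 + g ^ 2 * inner ℝ ξ v ^ 2 ≤ g ^ 2 * ‖ξ‖ ^ 2 := by
  set c := inner ℝ ξ v with hc
  have h1 : inner ℝ y (ξ - c • v) = inner ℝ y ξ := by
    rw [inner_sub_right, inner_smul_right, hyv]; ring
  have h2 : ‖ξ - c • v‖ ^ 2 = ‖ξ‖ ^ 2 - c ^ 2 := by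
    rw [norm_sub_sq_real, inner_smul_right, norm_smul, hv, ← hc, mul_one, Real.norm_eq_abs,
      sq_abs]; ring
  have h3 : inner ℝ y (ξ - c • v) ^ 2 ≤ (g * ‖ξ - c • v‖) ^ 2 := by
    rw [← sq_abs]
    refine pow_le_pow_left₀ (abs_nonneg _) ?_ 2
    exact (abs_real_inner_le_norm _ _).trans (mul_le_mul_of_nonneg_right hg (norm_nonneg _))
  rw [h1, mul_pow, h2] at h3
  linarith

/-- The transverse part of a step lengthens the position to second order: `‖ξ‖ ^ 2` minus the
squared radial component dominates `inner ℝ ξ v ^ 2`. Apart from the linear term, which is centered,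
this is the only gain; the two negative terms are made small by taking `B` large and `p` near `1`.
-/
theorem smoothNorm_rpow_sub_ge {B K p : ℝ} (hB : 0 < B) (hK : 0 ≤ K) (hp0 : 0 ≤ p) (hp1 : p ≤ 1)
    (hBK : 2 * K ≤ Real.sqrt B) {y v ξ : E} (hv : ‖v‖ = 1) (hyv : inner ℝ y v = 0)
    (hξ : ‖ξ‖ ≤ K) :
    p * smoothNorm B y ^ (p - 2) *
        (inner ℝ y ξ + inner ℝ ξ v ^ 2 / 2 - K ^ 3 / Real.sqrt B - 2 * (1 - p) * K ^ 2)
      ≤ smoothNorm B (y + ξ) ^ p - smoothNorm B y ^ p := by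
  have hpos := smoothNorm_pos hB y
  have hle := sqrt_le_smoothNorm B y
  have hsq : 0 < Real.sqrt B := Real.sqrt_pos.2 hB
  have hin : |inner ℝ y ξ| ≤ smoothNorm B y * K :=
    (abs_real_inner_le_norm _ _).trans
      (mul_le_mul (norm_le_smoothNorm hB.le y) hξ (norm_nonneg _) hpos.le)
  have h1 := rpow_sub_rpow_ge hp0 hp1 hpos hK ((abs_smoothNorm_add_sub_le hB.le y ξ).trans hξ)
    (smoothNorm_add_sq hB.le y ξ) hin (by positivity)
    (pow_le_pow_left₀ (norm_nonneg _) hξ 2) (hBK.trans hle)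
  refine le_trans (mul_le_mul_of_nonneg_left ?_ ?_) h1
  · have h2 := inner_sq_add_inner_sq_le (ξ := ξ) hv hyv (norm_le_smoothNorm hB.le y)
    have h3 : inner ℝ y ξ ^ 2 / smoothNorm B y ^ 2 ≤ ‖ξ‖ ^ 2 - inner ℝ ξ v ^ 2 := by
      rw [div_le_iff₀ (by positivity)]; linarith
    have h4 : K ^ 3 / smoothNorm B y ≤ K ^ 3 / Real.sqrt B := by gcongr
    linarith
  · exact mul_nonneg hp0 (Real.rpow_nonneg hpos.le _)

/-- Used at new sites, where nothing is known on the mean of the step. The decay in `g` of the loss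
is what makes `m` distinct new sites cost less than order `m`. -/
theorem smoothNorm_rpow_sub_ge_neg {B K p : ℝ} (hB : 0 < B) (hp0 : 0 ≤ p)
    (hp1 : p ≤ 1) (hBK : K ≤ Real.sqrt B) {y ξ : E} (hξ : ‖ξ‖ ≤ K) :
    -(K * smoothNorm B y ^ (p - 1)) ≤ smoothNorm B (y + ξ) ^ p - smoothNorm B y ^ p := by
  have hpos := smoothNorm_pos hB y
  have hle := sqrt_le_smoothNorm B y
  have h1 := (abs_le.1 ((abs_smoothNorm_add_sub_le hB.le y ξ).trans hξ)).1
  set g := smoothNorm B y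
  have hz0 : 0 ≤ 1 - K / g := by
    rw [sub_nonneg, div_le_one hpos]; linarith
  have hz1 : 1 - K / g ≤ 1 := by
    have : 0 ≤ K / g := div_nonneg ((norm_nonneg ξ).trans hξ) hpos.le
    linarith
  have h2 : (1 - K / g) ≤ (1 - K / g) ^ p := by
    rcases hz0.eq_or_lt with h | h
    · rw [← h]; exact Real.rpow_nonneg le_rfl _
    · simpa using Real.rpow_le_rpow_of_exponent_ge h hz1 hp1
  have h3 : (g * (1 - K / g)) ^ p ≤ smoothNorm B (y + ξ) ^ p := by
    refine Real.rpow_le_rpow (by positivity) ?_ hp0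
    have : g * (1 - K / g) = g - K := by field_simp
    linarith
  rw [Real.mul_rpow hpos.le hz0] at h3
  have h4 : g ^ p = g ^ (p - 1) * g := by
    rw [Real.rpow_sub_one hpos.ne']; field_simp
  have h5 : g ^ p * (1 - K / g) ≤ g ^ p * (1 - K / g) ^ p :=
    mul_le_mul_of_nonneg_left h2 (Real.rpow_nonneg hpos.le _)
  have h6 : g ^ p * (1 - K / g) = g ^ p - K * g ^ (p - 1) := by
    rw [h4]; field_simp
  linarith

end SmoothNorm

/-! ### Orthogonal directions, lattice boxes and countable fibres. -/

/-- Dimension at least two is essential here: on a line, a nonzero vector has no orthogonal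
direction. -/
theorem exists_norm_eq_one_inner_eq_zero {d : ℕ} (hd : 2 ≤ d) (y : EuclideanSpace ℝ (Fin d)) :
    ∃ v : EuclideanSpace ℝ (Fin d), ‖v‖ = 1 ∧ inner ℝ y v = 0 := by
  have h1 := Submodule.finrank_add_finrank_orthogonal (Submodule.span ℝ {y})
  have h2 : Module.finrank ℝ (Submodule.span ℝ {y}) ≤ 1 := (finrank_span_le_card {y}).trans (by simp)
  rw [finrank_euclideanSpace_fin] at h1
  have h3 : 0 < Module.finrank ℝ (Submodule.span ℝ {y})ᗮ := by omega
  have := Module.nontrivial_of_finrank_pos h3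
  obtain ⟨w, hw⟩ := exists_ne (0 : (Submodule.span ℝ {y})ᗮ)
  have hw' : (w : EuclideanSpace ℝ (Fin d)) ≠ 0 := by simpa using hw
  refine ⟨(‖(w : EuclideanSpace ℝ (Fin d))‖)⁻¹ • (w : EuclideanSpace ℝ (Fin d)), ?_, ?_⟩
  · rw [norm_smul, norm_inv, norm_norm, inv_mul_cancel₀ (norm_ne_zero_iff.2 hw')]
  · rw [inner_smul_right, Submodule.mem_orthogonal_singleton_iff_inner_right.1 w.2, mul_zero]

theorem latticePoint_sub {d : ℕ} (x y : Fin d → ℤ) :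
    latticePoint (x - y) = latticePoint x - latticePoint y := by
  ext i; simp [latticePoint]

theorem latticePoint_zero {d : ℕ} : latticePoint (0 : Fin d → ℤ) = 0 := by
  ext i; simp [latticePoint]

theorem abs_le_norm_latticePoint {d : ℕ} (x : Fin d → ℤ) (i : Fin d) :
    |(x i : ℝ)| ≤ ‖latticePoint x‖ := by
  simpa [latticePoint] using PiLp.norm_apply_le (latticePoint x) i

theorem mem_Icc_of_norm_latticePoint_le {d : ℕ} {x : Fin d → ℤ} {R : ℝ}
    (hx : ‖latticePoint x‖ ≤ R) :
    x ∈ Finset.Icc (fun _ : Fin d => -⌊R⌋) (fun _ : Fin d => ⌊R⌋) := by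
  rw [Finset.mem_Icc]
  constructor <;> intro i <;> have := abs_le.1 ((abs_le_norm_latticePoint x i).trans hx)
  · show -⌊R⌋ ≤ x i
    have : -x i ≤ ⌊R⌋ := Int.le_floor.2 (by push_cast; linarith)
    linarith
  · exact Int.le_floor.2 this.2

/-- Freezing a countably valued variable lets the direction and the coefficients of an estimate
depend on its value, with no measurable selection. -/
theorem integral_le_integral_of_fibers {Ω ι : Type*} {mΩ : MeasurableSpace Ω} {Q : Measure Ω}
    [Countable ι] [MeasurableSpace ι] [MeasurableSingletonClass ι] {V : Ω → ι} (hV : Measurable V)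
    {A : Set Ω} (hA : MeasurableSet A) {F G : Ω → ℝ} (hF : Integrable F Q) (hG : Integrable G Q)
    (h : ∀ y, ∫ ω in A ∩ V ⁻¹' {y}, F ω ∂Q ≤ ∫ ω in A ∩ V ⁻¹' {y}, G ω ∂Q) :
    ∫ ω in A, F ω ∂Q ≤ ∫ ω in A, G ω ∂Q := by
  have hU : A = ⋃ y, A ∩ V ⁻¹' {y} := by ext ω; simp
  have hm : ∀ y, MeasurableSet (A ∩ V ⁻¹' {y}) := fun y =>
    hA.inter (hV (measurableSet_singleton y))
  have hd : Pairwise (Function.onFun Disjoint fun y => A ∩ V ⁻¹' {y}) := by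
    intro a b hab
    refine Set.disjoint_left.2 ?_
    rintro ω ⟨-, h1⟩ ⟨-, h2⟩
    exact hab (h1.symm.trans h2)
  have h1 := hasSum_integral_iUnion (μ := Q) (f := F) hm hd hF.integrableOn
  have h2 := hasSum_integral_iUnion (μ := Q) (f := G) hm hd hG.integrableOn
  rw [← hU] at h1 h2
  exact hasSum_le h h1 h2

/-- A lattice process whose increments are centered and uniformly elliptic, given the past,
outside events `N n`; on `N n` the process is at a site that it had not visited before. -/
structure IsCenteredOff {d : ℕ} {Ω : Type*} {mΩ : MeasurableSpace Ω} (Q : Measure Ω)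
    (𝒢 : Filtration ℕ mΩ) (N : ℕ → Set Ω) (K h r : ℝ) (Y : ℕ → Ω → (Fin d → ℤ)) : Prop where
  adapted : ∀ n, Measurable[𝒢 n] (Y n)
  measurableSet_new : ∀ n, MeasurableSet[𝒢 n] (N n)
  bounded : ∀ n ω, ‖increment Y n ω‖ ≤ K
  ne_of_new : ∀ n, ∀ ω ∈ N n, ∀ k < n, Y k ω ≠ Y n ω
  centered : ∀ n A, MeasurableSet[𝒢 n] A → Disjoint A (N n) →
    ∀ w, ∫ ω in A, inner ℝ w (increment Y n ω) ∂Q = 0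
  elliptic : ∀ n A, MeasurableSet[𝒢 n] A → Disjoint A (N n) → ∀ v, ‖v‖ = 1 →
    h * Q.real A ≤ Q.real (A ∩ {ω | r < inner ℝ (increment Y n ω) v})

/-! ### Mean increments of the potentials at old sites. -/

namespace IsCenteredOff

variable {d : ℕ} {Ω : Type*} {mΩ : MeasurableSpace Ω} {Q : Measure Ω}
  {𝒢 : Filtration ℕ mΩ} {N : ℕ → Set Ω} {K h r : ℝ} {Y : ℕ → Ω → (Fin d → ℤ)}

theorem measurable (H : IsCenteredOff Q 𝒢 N K h r Y) (n : ℕ) : Measurable (Y n) :=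
  (H.adapted n).mono (𝒢.le n) le_rfl

theorem measurable_inner_increment (H : IsCenteredOff Q 𝒢 N K h r Y) (n : ℕ)
    (v : EuclideanSpace ℝ (Fin d)) : Measurable fun ω => inner ℝ (increment Y n ω) v := by
  have h1 : ∀ f : (Fin d → ℤ) × (Fin d → ℤ) → ℝ, Measurable f := fun f => Measurable.of_discrete
  have h2 := (h1 fun x => inner ℝ (latticePoint x.1 - latticePoint x.2) v).comp
      ((H.measurable (n + 1)).prodMk (H.measurable n))
  simpa only [increment, Function.comp_def] using h2

theorem abs_inner_increment_le (H : IsCenteredOff Q 𝒢 N K h r Y) (n : ℕ) (ω : Ω)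
    (v : EuclideanSpace ℝ (Fin d)) : |inner ℝ (increment Y n ω) v| ≤ K * ‖v‖ :=
  (abs_real_inner_le_norm _ _).trans (mul_le_mul_of_nonneg_right (H.bounded n ω) (norm_nonneg _))

theorem latticePoint_succ_sub (i j : ℕ) (ω : Ω) :
    latticePoint (Y (j + 1) ω - Y i ω) = latticePoint (Y j ω - Y i ω) + increment Y j ω := by
  rw [latticePoint_sub, latticePoint_sub, increment]; abel

theorem norm_latticePoint_sub_le (H : IsCenteredOff Q 𝒢 N K h r Y) {i j : ℕ} (hij : i ≤ j)
    (ω : Ω) : ‖latticePoint (Y j ω - Y i ω)‖ ≤ K * ((j : ℝ) - i) := by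
  induction j, hij using Nat.le_induction with
  | base => simp [latticePoint_zero]
  | succ j hij ih =>
    rw [latticePoint_succ_sub]
    refine (norm_add_le _ _).trans ?_
    have := H.bounded j ω
    push_cast; linarith

theorem measurable_sub (H : IsCenteredOff Q 𝒢 N K h r Y) {i j : ℕ} (hij : i ≤ j) :
    Measurable[𝒢 j] fun ω => Y j ω - Y i ω := by
  have hi : Measurable[𝒢 j] (Y i) := (H.adapted i).mono (𝒢.mono hij) le_rfl
  exact (Measurable.of_discrete (f := fun x : (Fin d → ℤ) × (Fin d → ℤ) => x.1 - x.2)).comp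
    ((H.adapted j).prodMk hi)

theorem measurableSet_return (H : IsCenteredOff Q 𝒢 N K h r Y) {i j : ℕ} (hij : i ≤ j) :
    MeasurableSet[𝒢 j] {ω | Y j ω = Y i ω} := by
  have : {ω | Y j ω = Y i ω} = (fun ω => Y j ω - Y i ω) ⁻¹' {0} := by
    ext ω; simp [sub_eq_zero]
  rw [this]
  exact H.measurable_sub hij (measurableSet_singleton 0)

variable [IsProbabilityMeasure Q]

theorem integrable_inner_increment (H : IsCenteredOff Q 𝒢 N K h r Y) (n : ℕ)
    (v : EuclideanSpace ℝ (Fin d)) : Integrable (fun ω => inner ℝ (increment Y n ω) v) Q :=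
  Integrable.of_bound (H.measurable_inner_increment n v).aestronglyMeasurable (K * ‖v‖)
    (ae_of_all _ fun ω => H.abs_inner_increment_le n ω v)

theorem integrable_comp_sub (H : IsCenteredOff Q 𝒢 N K h r Y) {i j : ℕ} (hij : i ≤ j)
    (ψ : (Fin d → ℤ) → ℝ) : Integrable (fun ω => ψ (Y j ω - Y i ω)) Q := by
  set s := Finset.Icc (fun _ : Fin d => -⌊K * ((j : ℝ) - i)⌋)
    (fun _ : Fin d => ⌊K * ((j : ℝ) - i)⌋) with hs
  have hm : Measurable fun ω => ψ (Y j ω - Y i ω) :=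
    (Measurable.of_discrete (f := fun x : (Fin d → ℤ) × (Fin d → ℤ) => ψ (x.1 - x.2))).comp
      ((H.measurable j).prodMk (H.measurable i))
  refine Integrable.of_bound hm.aestronglyMeasurable (∑ x ∈ s, |ψ x|) (ae_of_all _ fun ω => ?_)
  exact Finset.single_le_sum (f := fun x => |ψ x|) (fun _ _ => abs_nonneg _)
    (mem_Icc_of_norm_latticePoint_le (H.norm_latticePoint_sub_le hij ω))

theorem mul_measureReal_le_integral_sq (H : IsCenteredOff Q 𝒢 N K h r Y) (hr : 0 ≤ r) (j : ℕ)
    {A : Set Ω} (hA : MeasurableSet[𝒢 j] A) (hAN : Disjoint A (N j))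
    {v : EuclideanSpace ℝ (Fin d)} (hv : ‖v‖ = 1) :
    h * r ^ 2 * Q.real A ≤ ∫ ω in A, inner ℝ (increment Y j ω) v ^ 2 ∂Q := by
  set J : Set Ω := {ω | r < inner ℝ (increment Y j ω) v} with hJ
  have hJm : MeasurableSet J :=
    measurableSet_lt measurable_const (H.measurable_inner_increment j v)
  have hAm : MeasurableSet A := 𝒢.le j _ hA
  have hsq : Integrable (fun ω => inner ℝ (increment Y j ω) v ^ 2) Q := by
    refine Integrable.of_bound
      ((H.measurable_inner_increment j v).pow_const 2).aestronglyMeasurable ((K * ‖v‖) ^ 2)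
      (ae_of_all _ fun ω => ?_)
    rw [Real.norm_eq_abs, abs_pow]
    exact pow_le_pow_left₀ (abs_nonneg _) (H.abs_inner_increment_le j ω v) 2
  have h1 := H.elliptic j A hA hAN v hv
  have h2 : ∫ ω in A, J.indicator (fun _ => r ^ 2) ω ∂Q = Q.real (A ∩ J) * r ^ 2 := by
    rw [setIntegral_indicator hJm, setIntegral_const, smul_eq_mul]
  calc h * r ^ 2 * Q.real A = (h * Q.real A) * r ^ 2 := by ring
    _ ≤ Q.real (A ∩ J) * r ^ 2 := mul_le_mul_of_nonneg_right h1 (sq_nonneg _)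
    _ = ∫ ω in A, J.indicator (fun _ => r ^ 2) ω ∂Q := h2.symm
    _ ≤ _ := by
      refine setIntegral_mono ((integrable_const _).indicator hJm).integrableOn
        hsq.integrableOn fun ω => ?_
      by_cases hω : ω ∈ J
      · rw [Set.indicator_of_mem hω]
        exact pow_le_pow_left₀ hr (le_of_lt hω) 2
      · rw [Set.indicator_of_notMem hω]; positivity

/-- With the displacement frozen at `y`, one orthogonal direction serves on the whole event:
centering removes the linear term and ellipticity bounds the transverse second moment below by `h *
r ^ 2`. -/
theorem integral_smoothNorm_rpow_sub_ge_of_eq (H : IsCenteredOff Q 𝒢 N K h r Y) (hd : 2 ≤ d)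
    (hr : 0 ≤ r) {B p : ℝ} (hB : 0 < B) (hK : 0 ≤ K) (hp0 : 0 ≤ p) (hp1 : p ≤ 1)
    (hBK : 2 * K ≤ Real.sqrt B) {i j : ℕ} (hij : i ≤ j)
    {A : Set Ω} (hA : MeasurableSet[𝒢 j] A) (hAN : Disjoint A (N j)) {y : Fin d → ℤ}
    (hy : ∀ ω ∈ A, Y j ω - Y i ω = y) :
    p * smoothNorm B (latticePoint y) ^ (p - 2) *
        (h * r ^ 2 / 2 - K ^ 3 / Real.sqrt B - 2 * (1 - p) * K ^ 2) * Q.real A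
      ≤ ∫ ω in A, (smoothNorm B (latticePoint (Y (j + 1) ω - Y i ω)) ^ p
          - smoothNorm B (latticePoint (Y j ω - Y i ω)) ^ p) ∂Q := by
  obtain ⟨v, hv, hyv⟩ := exists_norm_eq_one_inner_eq_zero hd (latticePoint y)
  have hAm : MeasurableSet A := 𝒢.le j _ hA
  set a := p * smoothNorm B (latticePoint y) ^ (p - 2) with ha
  have ha0 : 0 ≤ a := mul_nonneg hp0 (Real.rpow_nonneg (smoothNorm_nonneg _ _) _)
  set c := K ^ 3 / Real.sqrt B + 2 * (1 - p) * K ^ 2 with hc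
  have hsq : Integrable (fun ω => inner ℝ (increment Y j ω) v ^ 2) Q := by
    refine Integrable.of_bound
      ((H.measurable_inner_increment j v).pow_const 2).aestronglyMeasurable ((K * ‖v‖) ^ 2)
      (ae_of_all _ fun ω => ?_)
    rw [Real.norm_eq_abs, abs_pow]
    exact pow_le_pow_left₀ (abs_nonneg _) (H.abs_inner_increment_le j ω v) 2
  have hlin : Integrable (fun ω => inner ℝ (latticePoint y) (increment Y j ω)) Q := by
    simpa only [real_inner_comm] using H.integrable_inner_increment j (latticePoint y)
  have h0 := H.centered j A hA hAN (latticePoint y)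
  have h2 := H.mul_measureReal_le_integral_sq hr j hA hAN hv
  have hI : ∫ ω in A, a * (inner ℝ (latticePoint y) (increment Y j ω)
      + inner ℝ (increment Y j ω) v ^ 2 / 2 - c) ∂Q
      = a * ((∫ ω in A, inner ℝ (increment Y j ω) v ^ 2 ∂Q) / 2 - c * Q.real A) := by
    rw [integral_const_mul, integral_sub, integral_add hlin.integrableOn
      (hsq.div_const 2).integrableOn, h0, integral_div, setIntegral_const, smul_eq_mul]
    · ring
    · exact (hlin.add (hsq.div_const 2)).integrableOn
    · exact (integrable_const _)
  calc _ = a * ((h * r ^ 2 * Q.real A) / 2 - c * Q.real A) := by rw [hc]; ring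
    _ ≤ a * ((∫ ω in A, inner ℝ (increment Y j ω) v ^ 2 ∂Q) / 2 - c * Q.real A) := by gcongr
    _ = _ := hI.symm
    _ ≤ _ := by
      refine setIntegral_mono_on
        (((hlin.add (hsq.div_const 2)).sub (integrable_const c)).const_mul a).integrableOn
        ((H.integrable_comp_sub (hij.trans (Nat.le_succ j))
          fun x => smoothNorm B (latticePoint x) ^ p).sub
          (H.integrable_comp_sub hij fun x => smoothNorm B (latticePoint x) ^ p)).integrableOn
        hAm fun ω hω => ?_
      rw [latticePoint_succ_sub, hy ω hω]
      have := smoothNorm_rpow_sub_ge hB hK hp0 hp1 hBK hv hyv (H.bounded j ω)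
      rw [hc]
      linarith

/-- Away from the new sites, the potential `smoothNorm B ^ p` is a submartingale which gains a
fixed amount at each visit of the origin. -/
theorem integral_smoothNorm_rpow_sub_ge (H : IsCenteredOff Q 𝒢 N K h r Y) (hd : 2 ≤ d)
    (hr : 0 ≤ r) {B p c : ℝ} (hB : 0 < B) (hK : 0 ≤ K) (hp0 : 0 ≤ p) (hp1 : p ≤ 1)
    (hBK : 2 * K ≤ Real.sqrt B) (hc0 : 0 ≤ c)
    (hc : c ≤ h * r ^ 2 / 2 - K ^ 3 / Real.sqrt B - 2 * (1 - p) * K ^ 2) {i j : ℕ} (hij : i ≤ j)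
    {A : Set Ω} (hA : MeasurableSet[𝒢 j] A) (hAN : Disjoint A (N j)) :
    p * Real.sqrt B ^ (p - 2) * c * Q.real (A ∩ {ω | Y j ω = Y i ω})
      ≤ ∫ ω in A, (smoothNorm B (latticePoint (Y (j + 1) ω - Y i ω)) ^ p
          - smoothNorm B (latticePoint (Y j ω - Y i ω)) ^ p) ∂Q := by
  have hAm : MeasurableSet A := 𝒢.le j _ hA
  set a := p * Real.sqrt B ^ (p - 2) * c with ha
  set Z : Set Ω := {ω | Y j ω = Y i ω} with hZ
  have hZm : MeasurableSet Z := 𝒢.le j _ (H.measurableSet_return hij)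
  have hV := H.measurable_sub hij
  have h1 : ∫ ω in A, Z.indicator (fun _ => a) ω ∂Q = a * Q.real (A ∩ Z) := by
    rw [setIntegral_indicator hZm, setIntegral_const, smul_eq_mul, mul_comm]
  rw [← h1]
  refine integral_le_integral_of_fibers (hV.mono (𝒢.le j) le_rfl) hAm
    ((integrable_const _).indicator hZm)
    ((H.integrable_comp_sub (hij.trans (Nat.le_succ j))
          fun x => smoothNorm B (latticePoint x) ^ p).sub
          (H.integrable_comp_sub hij fun x => smoothNorm B (latticePoint x) ^ p)) fun y => ?_
  have hA' : MeasurableSet[𝒢 j] (A ∩ (fun ω => Y j ω - Y i ω) ⁻¹' {y}) :=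
    hA.inter (hV (measurableSet_singleton y))
  have h2 := H.integral_smoothNorm_rpow_sub_ge_of_eq hd hr hB hK hp0 hp1 hBK hij hA'
    (hAN.mono_left Set.inter_subset_left) (y := y) (fun ω hω => hω.2)
  refine le_trans ?_ h2
  rw [setIntegral_indicator hZm, setIntegral_const, smul_eq_mul]
  have hg : 0 ≤ p * smoothNorm B (latticePoint y) ^ (p - 2) :=
    mul_nonneg hp0 (Real.rpow_nonneg (smoothNorm_nonneg _ _) _)
  -- Only the fibre of zero displacement carries the gain, with `smoothNorm` equal to `√B`; on the
  -- others nonnegativity is enough.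
  by_cases hy : y = 0
  · subst hy
    rw [latticePoint_zero, smoothNorm_zero, ha, mul_comm]
    have h3 : Q.real (A ∩ (fun ω => Y j ω - Y i ω) ⁻¹' {0} ∩ Z)
        ≤ Q.real (A ∩ (fun ω => Y j ω - Y i ω) ⁻¹' {0}) :=
      measureReal_mono Set.inter_subset_left
    refine mul_le_mul ?_ h3 measureReal_nonneg ?_
    · refine mul_le_mul_of_nonneg_left hc ?_
      simpa [latticePoint_zero, smoothNorm_zero] using hg
    · refine mul_nonneg ?_ (hc0.trans hc)
      simpa [latticePoint_zero, smoothNorm_zero] using hg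
  · have : A ∩ (fun ω => Y j ω - Y i ω) ⁻¹' {y} ∩ Z = ∅ := by
      ext ω
      simp only [Set.mem_inter_iff, Set.mem_preimage, Set.mem_singleton_iff, hZ,
        Set.mem_ofPred_eq, Set.mem_empty_iff_false, iff_false, not_and]
      rintro ⟨-, h4⟩ h5
      exact hy (by rw [← h4, h5, sub_self])
    rw [this, measureReal_empty, zero_mul]
    exact mul_nonneg (mul_nonneg hg (hc0.trans hc)) measureReal_nonneg

/-- The first-order term of the square root is centered, so only the second-order term remains. This
controls the mean distance from above. -/
theorem integral_smoothNorm_sub_le (H : IsCenteredOff Q 𝒢 N K h r Y) {B : ℝ} (hB : 0 < B)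
    {i j : ℕ} (hij : i ≤ j)
    {A : Set Ω} (hA : MeasurableSet[𝒢 j] A) (hAN : Disjoint A (N j)) :
    ∫ ω in A, (smoothNorm B (latticePoint (Y (j + 1) ω - Y i ω))
          - smoothNorm B (latticePoint (Y j ω - Y i ω))) ∂Q
      ≤ K ^ 2 / (2 * Real.sqrt B) * Q.real A := by
  have hAm : MeasurableSet A := 𝒢.le j _ hA
  have hV := H.measurable_sub hij
  have hsq : 0 < Real.sqrt B := Real.sqrt_pos.2 hB
  have h1 : ∫ ω in A, K ^ 2 / (2 * Real.sqrt B) ∂Q = K ^ 2 / (2 * Real.sqrt B) * Q.real A := by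
    rw [setIntegral_const, smul_eq_mul, mul_comm]
  have hint := (H.integrable_comp_sub (hij.trans (Nat.le_succ j))
    fun x => smoothNorm B (latticePoint x)).sub
    (H.integrable_comp_sub hij fun x => smoothNorm B (latticePoint x))
  rw [← h1]
  refine integral_le_integral_of_fibers (hV.mono (𝒢.le j) le_rfl) hAm hint
    (integrable_const _) fun y => ?_
  have hA' : MeasurableSet[𝒢 j] (A ∩ (fun ω => Y j ω - Y i ω) ⁻¹' {y}) :=
    hA.inter (hV (measurableSet_singleton y))
  have h0 := H.centered j _ hA' (hAN.mono_left Set.inter_subset_left) (latticePoint y)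
  have hlin : Integrable (fun ω => inner ℝ (latticePoint y) (increment Y j ω)) Q := by
    simpa only [real_inner_comm] using H.integrable_inner_increment j (latticePoint y)
  set g := smoothNorm B (latticePoint y)
  have h2 : ∫ ω in A ∩ (fun ω => Y j ω - Y i ω) ⁻¹' {y},
      (g⁻¹ * inner ℝ (latticePoint y) (increment Y j ω) + K ^ 2 / (2 * Real.sqrt B)) ∂Q
      = ∫ ω in A ∩ (fun ω => Y j ω - Y i ω) ⁻¹' {y}, K ^ 2 / (2 * Real.sqrt B) ∂Q := by
    rw [integral_add (hlin.const_mul _).integrableOn (integrable_const _), integral_const_mul, h0]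
    ring
  rw [← h2]
  refine setIntegral_mono_on hint.integrableOn
    ((hlin.const_mul _).add (integrable_const _)).integrableOn (𝒢.le j _ hA') fun ω hω => ?_
  rw [latticePoint_succ_sub, show Y j ω - Y i ω = y from hω.2]
  refine (smoothNorm_add_sub_le hB _ _).trans ?_
  have := pow_le_pow_left₀ (norm_nonneg _) (H.bounded j ω) 2
  gcongr

end IsCenteredOff

/-! ### Stopped sums, lattice sums and local times. -/

/-- A telescoping sum restricted to a decreasing condition is a stopped process. The index `t` does
not depend on `a`, so two potentials can be compared at the same stopping time. -/
theorem exists_sum_ite_sub_eq (s : ℕ → Prop) [DecidablePred s] (hs : ∀ j, s (j + 1) → s j)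
    {i n : ℕ} (hin : i ≤ n) :
    ∃ t, i ≤ t ∧ ∀ a : ℕ → ℝ,
      ∑ j ∈ Finset.Ico i n, (if s j then a (j + 1) - a j else 0) = a t - a i := by
  have key : ∃ t, i ≤ t ∧ (t = n ∨ ¬ s n) ∧ ∀ a : ℕ → ℝ,
      ∑ j ∈ Finset.Ico i n, (if s j then a (j + 1) - a j else 0) = a t - a i := by
    induction n, hin using Nat.le_induction with
    | base => exact ⟨i, le_rfl, Or.inl rfl, fun a => by simp⟩
    | succ n hin ih =>
      obtain ⟨t, hit, ht, ha⟩ := ih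
      by_cases hsn : s n
      · have htn : t = n := ht.resolve_right (not_not.2 hsn)
        subst htn
        refine ⟨t + 1, by omega, Or.inl rfl, fun a => ?_⟩
        rw [Finset.sum_Ico_succ_top hin, ha, if_pos hsn]; ring
      · refine ⟨t, hit, Or.inr fun h => hsn (hs n h), fun a => ?_⟩
        rw [Finset.sum_Ico_succ_top hin, ha, if_neg hsn, add_zero]
  obtain ⟨t, h1, -, h2⟩ := key
  exact ⟨t, h1, h2⟩

/-- Turns a bound on a first moment into one on a `p`-th moment: separate `u ≤ m` from `u ≥ m`. -/
theorem rpow_le_rpow_add_mul {u m p : ℝ} (hu : 0 ≤ u) (hm : 0 < m) (hp0 : 0 ≤ p) (hp1 : p ≤ 1) :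
    u ^ p ≤ m ^ p + m ^ (p - 1) * u := by
  have h1 : 0 < m ^ (p - 1) := Real.rpow_pos_of_pos hm _
  rcases le_total u m with h | h
  · have := Real.rpow_le_rpow hu h hp0
    nlinarith
  · have hu0 : 0 < u := hm.trans_le h
    have h2 : u ^ (p - 1) ≤ m ^ (p - 1) := Real.rpow_le_rpow_of_nonpos hm h (by linarith)
    have h3 : u ^ p = u ^ (p - 1) * u := by rw [Real.rpow_sub_one hu0.ne']; field_simp
    have h4 : 0 < m ^ p := Real.rpow_pos_of_pos hm _
    rw [h3]; nlinarith

theorem card_Icc_neg_floor_le (d : ℕ) {ρ : ℝ} (hρ : 1 ≤ ρ) :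
    ((Finset.Icc (fun _ : Fin d => -⌊ρ⌋) (fun _ : Fin d => ⌊ρ⌋)).card : ℝ) ≤ (3 * ρ) ^ d := by
  rw [Pi.card_Icc]
  simp only [Int.card_Icc, Finset.prod_const, Finset.card_univ, Fintype.card_fin, Nat.cast_pow]
  refine pow_le_pow_left₀ (Nat.cast_nonneg _) ?_ d
  have h0 : 0 ≤ ⌊ρ⌋ := Int.floor_nonneg.2 (by linarith)
  have h1 : ((⌊ρ⌋ + 1 - -⌊ρ⌋).toNat : ℝ) = ((⌊ρ⌋ + 1 - -⌊ρ⌋ : ℤ) : ℝ) := by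
    exact_mod_cast Int.toNat_of_nonneg (by linarith)
  rw [h1]; push_cast
  linarith [Int.floor_le ρ]

/-- Split at radius `m ^ (1 / (2 * d))`: the ball holds at most `3 ^ d * √m` lattice points, each
contributing at most `1`, and the points outside each contribute at most `m ^ (-q / (2 * d))`. -/
theorem sum_smoothNorm_rpow_le {d : ℕ} (hd : 1 ≤ d) {B m q : ℝ} (hB : 1 ≤ B) (hm : 1 ≤ m)
    (hq : 0 ≤ q) (S : Finset (Fin d → ℤ)) (hS : (S.card : ℝ) ≤ m) :
    ∑ x ∈ S, smoothNorm B (latticePoint x) ^ (-q)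
      ≤ 3 ^ d * m ^ (1 / 2 : ℝ) + m ^ (1 - q / (2 * d)) := by
  classical
  have hm0 : 0 < m := by linarith
  have hd0 : (d : ℝ) ≠ 0 := by positivity
  set ρ := m ^ (1 / (2 * d) : ℝ) with hρ
  have hρ1 : 1 ≤ ρ := Real.one_le_rpow hm (by positivity)
  have hg1 : ∀ x : Fin d → ℤ, 1 ≤ smoothNorm B (latticePoint x) := fun x =>
    le_trans (by rw [Real.one_le_sqrt]; exact hB) (sqrt_le_smoothNorm B _)
  rw [← Finset.sum_filter_add_sum_filter_not S (fun x => ‖latticePoint x‖ ≤ ρ)]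
  refine add_le_add ?_ ?_
  · calc ∑ x ∈ S with ‖latticePoint x‖ ≤ ρ, smoothNorm B (latticePoint x) ^ (-q)
        ≤ ∑ x ∈ S with ‖latticePoint x‖ ≤ ρ, (1 : ℝ) :=
          Finset.sum_le_sum fun x _ => Real.rpow_le_one_of_one_le_of_nonpos (hg1 x) (by linarith)
      _ = ((S.filter fun x => ‖latticePoint x‖ ≤ ρ).card : ℝ) := by simp
      _ ≤ ((Finset.Icc (fun _ : Fin d => -⌊ρ⌋) (fun _ : Fin d => ⌊ρ⌋)).card : ℝ) := by
          exact_mod_cast Finset.card_le_card fun x hx =>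
            mem_Icc_of_norm_latticePoint_le (Finset.mem_filter.1 hx).2
      _ ≤ (3 * ρ) ^ d := card_Icc_neg_floor_le d hρ1
      _ = 3 ^ d * m ^ (1 / 2 : ℝ) := by
          rw [mul_pow, hρ, ← Real.rpow_natCast (m ^ _) d, ← Real.rpow_mul hm0.le]
          congr 2; field_simp
  · calc ∑ x ∈ S with ¬ ‖latticePoint x‖ ≤ ρ, smoothNorm B (latticePoint x) ^ (-q)
        ≤ ∑ x ∈ S with ¬ ‖latticePoint x‖ ≤ ρ, ρ ^ (-q) := by
          refine Finset.sum_le_sum fun x hx => ?_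
          refine Real.rpow_le_rpow_of_nonpos (by linarith) ?_ (by linarith)
          exact (not_le.1 (Finset.mem_filter.1 hx).2).le.trans
            (norm_le_smoothNorm (by linarith) _)
      _ = ((S.filter fun x => ¬ ‖latticePoint x‖ ≤ ρ).card : ℝ) * ρ ^ (-q) := by simp
      _ ≤ m * ρ ^ (-q) := by
          refine mul_le_mul_of_nonneg_right (le_trans ?_ hS) (by positivity)
          exact_mod_cast Finset.card_filter_le _ _
      _ = m ^ (1 - q / (2 * d)) := by
          rw [hρ, ← Real.rpow_mul hm0.le, sub_eq_add_neg, Real.rpow_add hm0, Real.rpow_one]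
          congr 2; field_simp

theorem sum_sum_eq_add_two_mul {α : Type*} [DecidableEq α] (y : ℕ → α) (n : ℕ) :
    ∑ i ∈ Finset.range n, ∑ j ∈ Finset.range n, (if y j = y i then (1 : ℝ) else 0)
      = n + 2 * ∑ i ∈ Finset.range n, ∑ j ∈ Finset.Ioo i n, (if y j = y i then (1 : ℝ) else 0) := by
  have h1 : ∑ i ∈ Finset.range n, ∑ j ∈ Finset.Ioo i n, (if y j = y i then (1 : ℝ) else 0)
      = ∑ j ∈ Finset.range n, ∑ i ∈ Finset.range j, (if y j = y i then (1 : ℝ) else 0) := by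
    refine Finset.sum_comm' fun a b => ?_
    simp only [Finset.mem_range, Finset.mem_Ioo]; omega
  rw [h1]
  clear h1
  induction n with
  | zero => simp
  | succ n ih =>
    rw [Finset.sum_range_succ (fun i => ∑ j ∈ Finset.range (n + 1), _)]
    simp only [Finset.sum_range_succ _ n, Finset.sum_add_distrib]
    rw [ih]
    have : ∑ i ∈ Finset.range n, (if y n = y i then (1 : ℝ) else 0)
        = ∑ i ∈ Finset.range n, (if y i = y n then (1 : ℝ) else 0) :=
      Finset.sum_congr rfl fun i _ => by simp only [eq_comm]
    rw [this]
    push_cast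
    simp
    ring

/-- Cauchy–Schwarz for the local times `f`: they sum to `n` over the range, and the sum of their
squares counts the ordered pairs of times at a common site. -/
theorem sq_le_card_image_mul {α : Type*} [DecidableEq α] (y : ℕ → α) (n : ℕ) :
    (n : ℝ) ^ 2 ≤ (((Finset.range n).image y).card : ℝ) * (n + 2 *
      ∑ i ∈ Finset.range n, ∑ j ∈ Finset.Ioo i n, (if y j = y i then (1 : ℝ) else 0)) := by
  rw [← sum_sum_eq_add_two_mul]
  set f : α → ℝ := fun x => ∑ j ∈ Finset.range n, (if y j = x then (1 : ℝ) else 0) with hf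
  have h1 : ∑ x ∈ (Finset.range n).image y, f x = n := by
    rw [hf, Finset.sum_comm]
    rw [Finset.sum_congr rfl (g := fun _ => (1 : ℝ))]
    · simp
    · intro j hj
      rw [Finset.sum_ite_eq, if_pos (Finset.mem_image_of_mem y hj)]
  have h2 : ∑ x ∈ (Finset.range n).image y, f x ^ 2
      = ∑ i ∈ Finset.range n, ∑ j ∈ Finset.range n, (if y j = y i then (1 : ℝ) else 0) := by
    have : ∀ x, f x ^ 2 = ∑ i ∈ Finset.range n, (if y i = x then f (y i) else 0) := by
      intro x
      rw [sq]
      nth_rewrite 1 [hf]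
      rw [Finset.sum_mul]
      refine Finset.sum_congr rfl fun i _ => ?_
      split_ifs with h
      · rw [h, one_mul]
      · rw [zero_mul]
    simp only [this]
    rw [Finset.sum_comm]
    refine Finset.sum_congr rfl fun i hi => ?_
    rw [Finset.sum_ite_eq, if_pos (Finset.mem_image_of_mem y hi)]
  have h3 := sq_sum_le_card_mul_sum_sq (s := (Finset.range n).image y) (f := f)
  rw [h1, h2] at h3
  exact h3

/-- The number of times before `n` at which the events `N` occur. -/
noncomputable def occurrences {Ω : Type*} (N : ℕ → Set Ω) (n : ℕ) (ω : Ω) : ℝ :=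
  ∑ i ∈ Finset.range n, (N i).indicator (fun _ => (1 : ℝ)) ω

theorem occurrences_succ {Ω : Type*} (N : ℕ → Set Ω) (n : ℕ) (ω : Ω) :
    occurrences N (n + 1) ω = occurrences N n ω + (N n).indicator (fun _ => (1 : ℝ)) ω :=
  Finset.sum_range_succ _ _

theorem occurrences_le_succ {Ω : Type*} (N : ℕ → Set Ω) (n : ℕ) (ω : Ω) :
    occurrences N n ω ≤ occurrences N (n + 1) ω := by
  rw [occurrences_succ]
  linarith [Set.indicator_nonneg (s := N n) (f := fun _ => (1 : ℝ)) (fun _ _ => zero_le_one) ω]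

theorem occurrences_mono {Ω : Type*} (N : ℕ → Set Ω) (ω : Ω) :
    Monotone fun n => occurrences N n ω :=
  monotone_nat_of_le_succ fun n => occurrences_le_succ N n ω

/-- Up to and including time `j`, at most `m` of the events `N` have occurred. -/
def atMost {Ω : Type*} (N : ℕ → Set Ω) (m : ℝ) (j : ℕ) : Set Ω :=
  {ω | occurrences N (j + 1) ω ≤ m}

theorem sum_indicator_atMost_le {Ω : Type*} (N : ℕ → Set Ω) {m : ℝ} (hm : 0 ≤ m) (n : ℕ) (ω : Ω) :
    ∑ j ∈ Finset.range n, (atMost N m j ∩ N j).indicator (fun _ => (1 : ℝ)) ω ≤ m := by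
  induction n with
  | zero => simpa using hm
  | succ n ih =>
    by_cases h : ω ∈ atMost N m n
    · refine le_trans (Finset.sum_le_sum fun j _ => ?_) (show occurrences N (n + 1) ω ≤ m from h)
      exact Set.indicator_le_indicator_of_subset Set.inter_subset_right
        (fun _ => zero_le_one) ω
    · rw [Finset.sum_range_succ, Set.indicator_of_notMem (fun h' => h h'.1), add_zero]
      exact ih

/-! ### Expected returns before too many new sites. -/

namespace IsCenteredOff

variable {d : ℕ} {Ω : Type*} {mΩ : MeasurableSpace Ω} {Q : Measure Ω}
  {𝒢 : Filtration ℕ mΩ} {N : ℕ → Set Ω} {K h r : ℝ} {Y : ℕ → Ω → (Fin d → ℤ)}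

/-- The case `n = k + 1` matters: whether the site at time `k` is new is already known at time `k`,
which makes `atMost` an admissible stopping condition. -/
theorem measurable_occurrences (H : IsCenteredOff Q 𝒢 N K h r Y) {n k : ℕ} (hnk : n ≤ k + 1) :
    Measurable[𝒢 k] (occurrences N n) := by
  refine Finset.measurable_fun_sum _ fun i hi => ?_
  refine measurable_const.indicator (𝒢.mono ?_ _ (H.measurableSet_new i))
  have := Finset.mem_range.1 hi
  omega

theorem measurableSet_atMost (H : IsCenteredOff Q 𝒢 N K h r Y) (m : ℝ) (j : ℕ) :
    MeasurableSet[𝒢 j] (atMost N m j) :=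
  H.measurable_occurrences le_rfl measurableSet_Iic

/-- The displacements at new-site times are pairwise distinct, and at most `m` such times count
before stopping, so this is a sum over at most `m` distinct lattice points. -/
theorem sum_indicator_smoothNorm_rpow_le (H : IsCenteredOff Q 𝒢 N K h r Y) (hd : 1 ≤ d)
    {B m q : ℝ} (hB : 1 ≤ B) (hm : 1 ≤ m) (hq : 0 ≤ q) (i n : ℕ) (ω : Ω) :
    ∑ j ∈ Finset.Ico i n, (atMost N m j ∩ N j).indicator
        (fun ω => smoothNorm B (latticePoint (Y j ω - Y i ω)) ^ (-q)) ω
      ≤ 3 ^ d * m ^ (1 / 2 : ℝ) + m ^ (1 - q / (2 * d)) := by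
  classical
  set T := (Finset.Ico i n).filter fun j => ω ∈ atMost N m j ∩ N j with hT
  have h1 : ∑ j ∈ Finset.Ico i n, (atMost N m j ∩ N j).indicator
        (fun ω => smoothNorm B (latticePoint (Y j ω - Y i ω)) ^ (-q)) ω
      = ∑ j ∈ T, smoothNorm B (latticePoint (Y j ω - Y i ω)) ^ (-q) := by
    rw [hT, Finset.sum_filter]
    exact Finset.sum_congr rfl fun j _ => by rw [Set.indicator_apply]
  have hinj : Set.InjOn (fun j => Y j ω - Y i ω) T := by
    have hlt : ∀ a ∈ T, ∀ b ∈ T, Y a ω - Y i ω = Y b ω - Y i ω → ¬ a < b := by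
      intro a _ b hb hab hlt
      exact H.ne_of_new b ω (Finset.mem_filter.1 hb).2.2 a hlt (sub_left_inj.1 hab)
    intro a ha b hb hab
    exact le_antisymm (not_lt.1 (hlt b hb a ha hab.symm)) (not_lt.1 (hlt a ha b hb hab))
  have h2 : (T.card : ℝ) ≤ m := by
    refine le_trans ?_ (sum_indicator_atMost_le N (by linarith : 0 ≤ m) n ω)
    have : (T.card : ℝ) = ∑ j ∈ T, (1 : ℝ) := by simp
    rw [this, hT, Finset.sum_filter]
    refine le_trans (Finset.sum_le_sum_of_subset_of_nonneg (t := Finset.range n) ?_ ?_) ?_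
    · intro j hj
      exact Finset.mem_range.2 (Finset.mem_Ico.1 hj).2
    · intro j _ _
      split_ifs <;> norm_num
    · exact le_of_eq (Finset.sum_congr rfl fun j _ => by rw [Set.indicator_apply])
  rw [h1, ← Finset.sum_image (f := fun x => smoothNorm B (latticePoint x) ^ (-q)) hinj]
  refine sum_smoothNorm_rpow_le hd hB hm hq _ (le_trans ?_ h2)
  exact_mod_cast Finset.card_image_le

variable [IsProbabilityMeasure Q]

theorem sum_measureReal_atMost_le (H : IsCenteredOff Q 𝒢 N K h r Y) {m : ℝ} (hm : 0 ≤ m)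
    (i n : ℕ) : ∑ j ∈ Finset.Ico i n, Q.real (atMost N m j ∩ N j) ≤ m := by
  have hms : ∀ j, MeasurableSet (atMost N m j ∩ N j) := fun j =>
    𝒢.le j _ ((H.measurableSet_atMost m j).inter (H.measurableSet_new j))
  have h1 : ∑ j ∈ Finset.range n, Q.real (atMost N m j ∩ N j)
      = ∫ ω, ∑ j ∈ Finset.range n, (atMost N m j ∩ N j).indicator (fun _ => (1 : ℝ)) ω ∂Q := by
    rw [integral_finsetSum _ fun j _ => (integrable_const _).indicator (hms j)]
    exact Finset.sum_congr rfl fun j _ => by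
      rw [integral_indicator (hms j), setIntegral_const, smul_eq_mul, mul_one]
  calc ∑ j ∈ Finset.Ico i n, Q.real (atMost N m j ∩ N j)
      ≤ ∑ j ∈ Finset.range n, Q.real (atMost N m j ∩ N j) :=
        Finset.sum_le_sum_of_subset_of_nonneg
          (fun j hj => Finset.mem_range.2 (Finset.mem_Ico.1 hj).2)
          fun _ _ _ => measureReal_nonneg
    _ ≤ ∫ _, m ∂Q := by
        rw [h1]
        refine integral_mono (integrable_finsetSum _ fun j _ =>
          (integrable_const _).indicator (hms j)) (integrable_const _) fun ω =>
          sum_indicator_atMost_le N hm n ω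
    _ = m := by simp

theorem integral_smoothNorm_sub_le_of_atMost (H : IsCenteredOff Q 𝒢 N K h r Y) {B m : ℝ}
    (hB : 0 < B) (hK : 0 ≤ K) (hm : 0 ≤ m) (i n : ℕ) :
    ∑ j ∈ Finset.Ico i n, ∫ ω in atMost N m j,
        (smoothNorm B (latticePoint (Y (j + 1) ω - Y i ω))
          - smoothNorm B (latticePoint (Y j ω - Y i ω))) ∂Q
      ≤ n * (K ^ 2 / (2 * Real.sqrt B)) + K * m := by
  have hint : ∀ j, i ≤ j → Integrable (fun ω => smoothNorm B (latticePoint (Y (j + 1) ω - Y i ω))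
      - smoothNorm B (latticePoint (Y j ω - Y i ω))) Q := fun j hij =>
    (H.integrable_comp_sub (hij.trans (Nat.le_succ j)) fun x => smoothNorm B (latticePoint x)).sub
      (H.integrable_comp_sub hij fun x => smoothNorm B (latticePoint x))
  have hs0 : 0 ≤ K ^ 2 / (2 * Real.sqrt B) := by positivity
  have h1 : ∀ j ∈ Finset.Ico i n, ∫ ω in atMost N m j,
        (smoothNorm B (latticePoint (Y (j + 1) ω - Y i ω))
          - smoothNorm B (latticePoint (Y j ω - Y i ω))) ∂Q
      ≤ K ^ 2 / (2 * Real.sqrt B) + K * Q.real (atMost N m j ∩ N j) := by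
    intro j hj
    have hij := (Finset.mem_Ico.1 hj).1
    have hNm : MeasurableSet (N j) := 𝒢.le j _ (H.measurableSet_new j)
    have hAm : MeasurableSet (atMost N m j) := 𝒢.le j _ (H.measurableSet_atMost m j)
    rw [← integral_inter_add_sdiff hNm (hint j hij).integrableOn, add_comm]
    refine add_le_add ?_ ?_
    · refine (H.integral_smoothNorm_sub_le hB hij
        ((H.measurableSet_atMost m j).diff (H.measurableSet_new j)) Set.disjoint_sdiff_left).trans ?_
      exact mul_le_of_le_one_right hs0 measureReal_le_one
    · calc _ ≤ ∫ ω in atMost N m j ∩ N j, K ∂Q := by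
            refine setIntegral_mono (hint j hij).integrableOn (integrable_const _) fun ω => ?_
            rw [latticePoint_succ_sub]
            exact (le_abs_self _).trans
              ((abs_smoothNorm_add_sub_le hB.le _ _).trans (H.bounded j ω))
        _ = _ := by rw [setIntegral_const, smul_eq_mul, mul_comm]
  refine (Finset.sum_le_sum h1).trans ?_
  rw [Finset.sum_add_distrib, ← Finset.mul_sum, Finset.sum_const, Nat.card_Ico, nsmul_eq_mul]
  refine add_le_add (mul_le_mul_of_nonneg_right ?_ hs0)
    (mul_le_mul_of_nonneg_left (H.sum_measureReal_atMost_le hm i n) hK)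
  exact_mod_cast Nat.sub_le n i

theorem integral_smoothNorm_rpow_sub_ge_of_atMost (H : IsCenteredOff Q 𝒢 N K h r Y) (hd : 2 ≤ d)
    (hr : 0 ≤ r) {B p c m : ℝ} (hB : 1 ≤ B) (hK : 0 ≤ K) (hp0 : 0 ≤ p) (hp1 : p ≤ 1)
    (hBK : 2 * K ≤ Real.sqrt B) (hc0 : 0 ≤ c)
    (hc : c ≤ h * r ^ 2 / 2 - K ^ 3 / Real.sqrt B - 2 * (1 - p) * K ^ 2) (hm : 1 ≤ m) (i n : ℕ) :
    p * Real.sqrt B ^ (p - 2) * c *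
        ∑ j ∈ Finset.Ico i n, Q.real ((atMost N m j \ N j) ∩ {ω | Y j ω = Y i ω})
      - K * (3 ^ d * m ^ (1 / 2 : ℝ) + m ^ (1 - (1 - p) / (2 * d)))
      ≤ ∑ j ∈ Finset.Ico i n, ∫ ω in atMost N m j,
        (smoothNorm B (latticePoint (Y (j + 1) ω - Y i ω)) ^ p
          - smoothNorm B (latticePoint (Y j ω - Y i ω)) ^ p) ∂Q := by
  have hB0 : 0 < B := by linarith
  have hi2 : ∀ j, i ≤ j → ∀ q : ℝ,
      Integrable (fun ω => smoothNorm B (latticePoint (Y j ω - Y i ω)) ^ q) Q := fun j hij q =>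
    H.integrable_comp_sub hij fun x => smoothNorm B (latticePoint x) ^ q
  have hi1 : ∀ j, i ≤ j → ∀ q : ℝ,
      Integrable (fun ω => smoothNorm B (latticePoint (Y (j + 1) ω - Y i ω)) ^ q) Q :=
    fun j hij q => H.integrable_comp_sub (hij.trans (Nat.le_succ j))
      fun x => smoothNorm B (latticePoint x) ^ q
  have hNm : ∀ j, MeasurableSet (N j) := fun j => 𝒢.le j _ (H.measurableSet_new j)
  have hAm : ∀ j, MeasurableSet (atMost N m j) := fun j => 𝒢.le j _ (H.measurableSet_atMost m j)
  have h1 : ∀ j ∈ Finset.Ico i n,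
      p * Real.sqrt B ^ (p - 2) * c * Q.real ((atMost N m j \ N j) ∩ {ω | Y j ω = Y i ω})
      - K * ∫ ω, (atMost N m j ∩ N j).indicator
        (fun ω => smoothNorm B (latticePoint (Y j ω - Y i ω)) ^ (-(1 - p))) ω ∂Q
      ≤ ∫ ω in atMost N m j,
        (smoothNorm B (latticePoint (Y (j + 1) ω - Y i ω)) ^ p
          - smoothNorm B (latticePoint (Y j ω - Y i ω)) ^ p) ∂Q := by
    intro j hj
    have hij := (Finset.mem_Ico.1 hj).1
    have hi12 : Integrable (fun ω => smoothNorm B (latticePoint (Y (j + 1) ω - Y i ω)) ^ p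
        - smoothNorm B (latticePoint (Y j ω - Y i ω)) ^ p) Q := (hi1 j hij p).sub (hi2 j hij p)
    rw [← integral_inter_add_sdiff (hNm j) hi12.integrableOn,
      add_comm, sub_eq_add_neg]
    refine add_le_add ?_ ?_
    · exact H.integral_smoothNorm_rpow_sub_ge hd hr hB0 hK hp0 hp1 hBK hc0 hc hij
        ((H.measurableSet_atMost m j).diff (H.measurableSet_new j)) Set.disjoint_sdiff_left
    · rw [integral_indicator ((hAm j).inter (hNm j)), ← integral_const_mul, ← integral_neg]
      refine setIntegral_mono ((hi2 j hij _).const_mul K).neg.integrableOn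
        ((hi1 j hij p).sub (hi2 j hij p)).integrableOn fun ω => ?_
      simp only
      rw [latticePoint_succ_sub, neg_sub]
      exact smoothNorm_rpow_sub_ge_neg hB0 hp0 hp1 (by linarith) (H.bounded j ω)
  refine le_trans ?_ (Finset.sum_le_sum h1)
  rw [Finset.sum_sub_distrib, ← Finset.mul_sum, ← Finset.mul_sum]
  refine sub_le_sub_left (mul_le_mul_of_nonneg_left ?_ hK) _
  rw [← integral_finsetSum _ fun j hj =>
    (hi2 j (Finset.mem_Ico.1 hj).1 _).indicator ((hAm j).inter (hNm j))]
  calc _ ≤ ∫ _, (3 ^ d * m ^ (1 / 2 : ℝ) + m ^ (1 - (1 - p) / (2 * d))) ∂Q := by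
        refine integral_mono (integrable_finsetSum _ fun j hj =>
          (hi2 j (Finset.mem_Ico.1 hj).1 _).indicator ((hAm j).inter (hNm j)))
          (integrable_const _) fun ω => ?_
        exact H.sum_indicator_smoothNorm_rpow_le (by omega) hB hm (by linarith) i n ω
    _ = _ := by simp

/-- The returns are paid for by the growth of the potential up to the stopping time. Its final value
is bounded, via `rpow_le_rpow_add_mul` at scale `m`, by the mean of a second smoothed norm with `B +
n` in place of `B`; with this parameter the `n` centered steps contribute only order `√n` to that
mean. -/
theorem sum_measureReal_return_le (H : IsCenteredOff Q 𝒢 N K h r Y) (hd : 2 ≤ d)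
    (hr : 0 ≤ r) {B p c m : ℝ} (hB : 1 ≤ B) (hK : 0 ≤ K) (hp0 : 0 ≤ p) (hp1 : p ≤ 1)
    (hBK : 2 * K ≤ Real.sqrt B) (hc0 : 0 ≤ c)
    (hc : c ≤ h * r ^ 2 / 2 - K ^ 3 / Real.sqrt B - 2 * (1 - p) * K ^ 2) (hm : 1 ≤ m)
    {i n : ℕ} (hin : i ≤ n) :
    p * Real.sqrt B ^ (p - 2) * c *
        ∑ j ∈ Finset.Ico i n, Q.real ((atMost N m j \ N j) ∩ {ω | Y j ω = Y i ω})
      ≤ m ^ p + m ^ (p - 1) * (Real.sqrt (B + n) + (n * (K ^ 2 / (2 * Real.sqrt (B + n))) + K * m))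
        + K * (3 ^ d * m ^ (1 / 2 : ℝ) + m ^ (1 - (1 - p) / (2 * d))) := by
  classical
  have hB0 : 0 < B := by linarith
  have hBn : 0 < B + n := by positivity
  have hm0 : 0 < m := by linarith
  have h1 := H.integral_smoothNorm_rpow_sub_ge_of_atMost hd hr hB hK hp0 hp1 hBK hc0 hc hm i n
  have h2 := H.integral_smoothNorm_sub_le_of_atMost hBn hK hm0.le i n
  have hAm : ∀ j, MeasurableSet (atMost N m j) := fun j => 𝒢.le j _ (H.measurableSet_atMost m j)
  have hpt : ∀ ω, ∑ j ∈ Finset.Ico i n, (atMost N m j).indicator (fun ω =>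
        smoothNorm B (latticePoint (Y (j + 1) ω - Y i ω)) ^ p
          - smoothNorm B (latticePoint (Y j ω - Y i ω)) ^ p) ω
      ≤ m ^ p + m ^ (p - 1) * (Real.sqrt (B + n) +
        ∑ j ∈ Finset.Ico i n, (atMost N m j).indicator (fun ω =>
          smoothNorm (B + n) (latticePoint (Y (j + 1) ω - Y i ω))
            - smoothNorm (B + n) (latticePoint (Y j ω - Y i ω))) ω) := by
    intro ω
    obtain ⟨t, hit, ht⟩ := exists_sum_ite_sub_eq (fun j => ω ∈ atMost N m j)
      (fun j hj => (occurrences_le_succ N (j + 1) ω).trans hj) hin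
    simp only [Set.indicator_apply]
    rw [ht fun j => smoothNorm B (latticePoint (Y j ω - Y i ω)) ^ p,
      ht fun j => smoothNorm (B + n) (latticePoint (Y j ω - Y i ω))]
    simp only [sub_self, latticePoint_zero, smoothNorm_zero]
    have h3 := rpow_le_rpow_add_mul (smoothNorm_nonneg (B + n) (latticePoint (Y t ω - Y i ω)))
      hm0 hp0 hp1
    have h4 : smoothNorm B (latticePoint (Y t ω - Y i ω)) ^ p
        ≤ smoothNorm (B + n) (latticePoint (Y t ω - Y i ω)) ^ p := by
      refine Real.rpow_le_rpow (smoothNorm_nonneg _ _) (Real.sqrt_le_sqrt ?_) hp0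
      have : (0 : ℝ) ≤ n := Nat.cast_nonneg n
      linarith
    have h5 : 0 ≤ Real.sqrt B ^ p := Real.rpow_nonneg (Real.sqrt_nonneg _) _
    rw [add_sub_cancel]
    linarith
  have hi1 : ∀ j ∈ Finset.Ico i n, Integrable ((atMost N m j).indicator (fun ω =>
        smoothNorm B (latticePoint (Y (j + 1) ω - Y i ω)) ^ p
          - smoothNorm B (latticePoint (Y j ω - Y i ω)) ^ p)) Q := fun j hj =>
    ((H.integrable_comp_sub ((Finset.mem_Ico.1 hj).1.trans (Nat.le_succ j))
      fun x => smoothNorm B (latticePoint x) ^ p).sub (H.integrable_comp_sub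
      (Finset.mem_Ico.1 hj).1 fun x => smoothNorm B (latticePoint x) ^ p)).indicator (hAm j)
  have hi2 : ∀ j ∈ Finset.Ico i n, Integrable ((atMost N m j).indicator (fun ω =>
        smoothNorm (B + n) (latticePoint (Y (j + 1) ω - Y i ω))
          - smoothNorm (B + n) (latticePoint (Y j ω - Y i ω)))) Q := fun j hj =>
    ((H.integrable_comp_sub ((Finset.mem_Ico.1 hj).1.trans (Nat.le_succ j))
      fun x => smoothNorm (B + n) (latticePoint x)).sub (H.integrable_comp_sub
      (Finset.mem_Ico.1 hj).1 fun x => smoothNorm (B + n) (latticePoint x))).indicator (hAm j)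
  have hi3 : Integrable (fun ω => Real.sqrt (B + n) +
        ∑ j ∈ Finset.Ico i n, (atMost N m j).indicator (fun ω =>
          smoothNorm (B + n) (latticePoint (Y (j + 1) ω - Y i ω))
            - smoothNorm (B + n) (latticePoint (Y j ω - Y i ω))) ω) Q :=
    (integrable_const _).add (integrable_finsetSum _ hi2)
  have h6 := integral_mono (integrable_finsetSum _ hi1)
    ((integrable_const (m ^ p)).add (hi3.const_mul (m ^ (p - 1)))) hpt
  simp only [Pi.add_apply] at h6
  rw [integral_add (integrable_const _) (hi3.const_mul (m ^ (p - 1))), integral_const_mul,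
    integral_add (integrable_const _) (integrable_finsetSum _ hi2),
    integral_finsetSum _ hi1, integral_finsetSum _ hi2] at h6
  simp only [integral_const, probReal_univ, one_smul, integral_indicator (hAm _)] at h6
  have h7 := mul_le_mul_of_nonneg_left (add_le_add_right h2 (Real.sqrt (B + n)))
    (Real.rpow_nonneg hm0.le (p - 1))
  linarith

end IsCenteredOff

universe u

/-- For `m ≥ √n` the mean stopped distance is `O(m)`. Since `1 / 2 ≤ p`, both exponents `p` and `1 /
2` are at most `1 - (1 - p) / (2 * d)`. -/
theorem potential_bound_le {d : ℕ} (hd : 2 ≤ d) {B K p m n : ℝ} (hK : 0 ≤ K)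
    (hp0 : 1 / 2 ≤ p) (hp1 : p ≤ 1) (hB : 1 ≤ B) (hBn : B ≤ n) (hm : Real.sqrt n ≤ m) :
    m ^ p + m ^ (p - 1) * (Real.sqrt (B + n) + (n * (K ^ 2 / (2 * Real.sqrt (B + n))) + K * m))
        + K * (3 ^ d * m ^ (1 / 2 : ℝ) + m ^ (1 - (1 - p) / (2 * d)))
      ≤ (3 + K ^ 2 + K + K * (3 ^ d + 1)) * m ^ (1 - (1 - p) / (2 * d)) := by
  have hd' : (2 : ℝ) ≤ d := by exact_mod_cast hd
  have hn1 : 1 ≤ n := hB.trans hBn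
  have hsn : 1 ≤ Real.sqrt n := Real.one_le_sqrt.2 hn1
  have hm1 : 1 ≤ m := hsn.trans hm
  have hm0 : 0 < m := by linarith
  have hfrac0 : (1 - p) / (2 * d) ≤ 1 - p := div_le_self (by linarith) (by linarith)
  set e := m ^ (1 - (1 - p) / (2 * d)) with he
  have e1 : m ^ p ≤ e := Real.rpow_le_rpow_of_exponent_le hm1 (by linarith)
  have e2 : m ^ (1 / 2 : ℝ) ≤ e := Real.rpow_le_rpow_of_exponent_le hm1 (by linarith)
  have h1 : Real.sqrt (B + n) ≤ 2 * m := by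
    rw [Real.sqrt_le_left (by linarith)]
    have := Real.sq_sqrt (by linarith : 0 ≤ n)
    nlinarith
  have h2 : n * (K ^ 2 / (2 * Real.sqrt (B + n))) ≤ K ^ 2 * m := by
    have h3 : Real.sqrt n ≤ Real.sqrt (B + n) := Real.sqrt_le_sqrt (by linarith)
    have h4 : n ≤ m * Real.sqrt (B + n) := by
      calc n = Real.sqrt n * Real.sqrt n := (Real.mul_self_sqrt (by linarith)).symm
        _ ≤ _ := mul_le_mul hm h3 (by linarith) hm0.le
    have h5 : 0 < Real.sqrt (B + n) := by linarith
    rw [← mul_div_assoc, div_le_iff₀ (by positivity)]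
    nlinarith [sq_nonneg K, mul_nonneg (sq_nonneg K) (mul_nonneg hm0.le h5.le)]
  have h6 : m ^ (p - 1) * (Real.sqrt (B + n) + (n * (K ^ 2 / (2 * Real.sqrt (B + n))) + K * m))
      ≤ (2 + K ^ 2 + K) * m ^ p := by
    have : m ^ p = m ^ (p - 1) * m := by rw [Real.rpow_sub_one hm0.ne']; field_simp
    rw [this]
    have h7 := mul_le_mul_of_nonneg_left (by linarith :
      Real.sqrt (B + n) + (n * (K ^ 2 / (2 * Real.sqrt (B + n))) + K * m)
        ≤ (2 + K ^ 2 + K) * m) (Real.rpow_nonneg hm0.le (p - 1))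
    linarith
  have h8 := mul_le_mul_of_nonneg_left e1 (by positivity : 0 ≤ 2 + K ^ 2 + K)
  have h9 := mul_le_mul_of_nonneg_left e2 (by positivity : 0 ≤ K * 3 ^ d)
  nlinarith

/-! ### From few returns to many new sites. -/

namespace IsCenteredOff

variable {d : ℕ} {Ω : Type u} {mΩ : MeasurableSpace Ω} {Q : Measure Ω}
  {𝒢 : Filtration ℕ mΩ} {N : ℕ → Set Ω} {K h r : ℝ} {Y : ℕ → Ω → (Fin d → ℤ)}

theorem sq_le_sum_indicator_return (H : IsCenteredOff Q 𝒢 N K h r Y) {n : ℕ} {m : ℝ}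
    (hm : 1 ≤ m) (hmn : 4 * m ≤ n) {k₀ : ℕ} (hk₀ : (k₀ : ℝ) ≤ m) {ω : Ω}
    (hrange : (((Finset.range n).image fun j => Y j ω).card : ℝ) ≤ occurrences N n ω + k₀)
    (hω : occurrences N n ω ≤ m) :
    (n : ℝ) ^ 2 ≤ 8 * m * ∑ i ∈ Finset.range n, ∑ j ∈ Finset.Ico i n,
      ((atMost N m j \ N j) ∩ {ω | Y j ω = Y i ω}).indicator (fun _ => (1 : ℝ)) ω := by
  classical
  have h1 := sq_le_card_image_mul (fun j => Y j ω) n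
  set P := ∑ i ∈ Finset.range n, ∑ j ∈ Finset.Ioo i n, (if Y j ω = Y i ω then (1 : ℝ) else 0)
    with hP
  have hP0 : 0 ≤ P := Finset.sum_nonneg fun i _ => Finset.sum_nonneg fun j _ => by
    split_ifs <;> norm_num
  have h2 : P ≤ ∑ i ∈ Finset.range n, ∑ j ∈ Finset.Ico i n,
      ((atMost N m j \ N j) ∩ {ω | Y j ω = Y i ω}).indicator (fun _ => (1 : ℝ)) ω := by
    refine Finset.sum_le_sum fun i _ => ?_
    refine le_trans (Finset.sum_le_sum fun j hj => ?_) (Finset.sum_le_sum_of_subset_of_nonneg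
      Finset.Ioo_subset_Ico_self fun j _ _ => Set.indicator_nonneg (fun _ _ => zero_le_one) ω)
    obtain ⟨hij, hjn⟩ := Finset.mem_Ioo.1 hj
    split_ifs with heq
    · rw [Set.indicator_of_mem]
      exact ⟨⟨(occurrences_mono N ω hjn).trans hω,
        fun hN => H.ne_of_new j ω hN i hij heq.symm⟩, heq⟩
    · exact Set.indicator_nonneg (fun _ _ => zero_le_one) ω
  have h3 : (n : ℝ) ^ 2 ≤ 2 * m * (n + 2 * P) := by
    refine h1.trans (mul_le_mul_of_nonneg_right (by linarith) (by positivity))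
  -- As `4 * m ≤ n`, the diagonal contribution `2 * m * n` is at most half of `n ^ 2` and is
  -- absorbed.
  have h4 : (n : ℝ) ^ 2 ≤ 8 * m * P := by nlinarith
  exact h4.trans (mul_le_mul_of_nonneg_left h2 (by linarith))

variable [IsProbabilityMeasure Q]

/-- Markov's inequality for the number of coinciding pairs: it is at least `n ^ 2 / (8 * m)` on the
event, and its mean is at most `n * b`. -/
theorem measureReal_occurrences_le (H : IsCenteredOff Q 𝒢 N K h r Y) {n : ℕ} {m : ℝ}
    (hm : 1 ≤ m) (hmn : 4 * m ≤ n) {k₀ : ℕ} (hk₀ : (k₀ : ℝ) ≤ m)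
    (hrange : ∀ ω, (((Finset.range n).image fun j => Y j ω).card : ℝ) ≤ occurrences N n ω + k₀)
    {b : ℝ} (hb : ∀ i ∈ Finset.range n,
      ∑ j ∈ Finset.Ico i n, Q.real ((atMost N m j \ N j) ∩ {ω | Y j ω = Y i ω}) ≤ b) :
    Q.real {ω | occurrences N n ω ≤ m} ≤ 8 * m * b / n := by
  have hn : (0 : ℝ) < n := by linarith
  have hE : MeasurableSet {ω | occurrences N n ω ≤ m} :=
    𝒢.le n _ (H.measurable_occurrences (Nat.le_succ n) measurableSet_Iic)
  have hS : ∀ i j, i ≤ j → MeasurableSet ((atMost N m j \ N j) ∩ {ω | Y j ω = Y i ω}) :=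
    fun i j hij => 𝒢.le j _ (((H.measurableSet_atMost m j).diff (H.measurableSet_new j)).inter
      (H.measurableSet_return hij))
  have hint : ∀ i, ∀ j ∈ Finset.Ico i n, Integrable
      (((atMost N m j \ N j) ∩ {ω | Y j ω = Y i ω}).indicator (fun _ => (1 : ℝ))) Q :=
    fun i j hj => (integrable_const _).indicator (hS i j (Finset.mem_Ico.1 hj).1)
  have hint2 : ∀ i ∈ Finset.range n, Integrable (fun ω => ∑ j ∈ Finset.Ico i n,
      ((atMost N m j \ N j) ∩ {ω | Y j ω = Y i ω}).indicator (fun _ => (1 : ℝ)) ω) Q :=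
    fun i _ => integrable_finsetSum _ (hint i)
  have h1 : ∫ ω, {ω | occurrences N n ω ≤ m}.indicator (fun _ => (n : ℝ) ^ 2) ω ∂Q
      ≤ ∫ ω, 8 * m * ∑ i ∈ Finset.range n, ∑ j ∈ Finset.Ico i n,
        ((atMost N m j \ N j) ∩ {ω | Y j ω = Y i ω}).indicator (fun _ => (1 : ℝ)) ω ∂Q := by
    refine integral_mono ((integrable_const _).indicator hE)
      ((integrable_finsetSum _ hint2).const_mul _) fun ω => ?_
    by_cases hω : ω ∈ {ω | occurrences N n ω ≤ m}
    · rw [Set.indicator_of_mem hω]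
      exact H.sq_le_sum_indicator_return hm hmn hk₀ (hrange ω) hω
    · rw [Set.indicator_of_notMem hω]
      exact mul_nonneg (by linarith) (Finset.sum_nonneg fun i _ => Finset.sum_nonneg fun j _ =>
        Set.indicator_nonneg (fun _ _ => zero_le_one) ω)
  rw [integral_indicator hE, setIntegral_const, smul_eq_mul, integral_const_mul,
    integral_finsetSum _ hint2] at h1
  have h2 : ∑ i ∈ Finset.range n, ∫ ω, ∑ j ∈ Finset.Ico i n,
      ((atMost N m j \ N j) ∩ {ω | Y j ω = Y i ω}).indicator (fun _ => (1 : ℝ)) ω ∂Q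
      ≤ ∑ i ∈ Finset.range n, b := by
    refine Finset.sum_le_sum fun i hi => ?_
    rw [integral_finsetSum _ (hint i)]
    refine le_trans (le_of_eq (Finset.sum_congr rfl fun j hj => ?_)) (hb i hi)
    rw [integral_indicator (hS i j (Finset.mem_Ico.1 hj).1), setIntegral_const, smul_eq_mul,
      mul_one]
  rw [Finset.sum_const, Finset.card_range, nsmul_eq_mul] at h2
  have h3 := mul_le_mul_of_nonneg_left h2 (by linarith : 0 ≤ 8 * m)
  rw [le_div_iff₀ hn]
  have h4 := h1.trans h3
  have h5 : (Q.real {ω | occurrences N n ω ≤ m} * n) * n ≤ (8 * m * b) * n := by linarith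
  exact le_of_mul_le_mul_right h5 hn

end IsCenteredOff

theorem range_exponent_bound {η x : ℝ} (hx : 1 ≤ x) :
    x ^ (1 / 2 + η / 8) * (x ^ (1 / 2 + η / 8)) ^ (1 - η) / x ≤ x ^ (-(η / 4)) := by
  have hx0 : 0 < x := by linarith
  rw [← Real.rpow_mul hx0.le, ← Real.rpow_add hx0, ← Real.rpow_sub_one hx0.ne']
  refine Real.rpow_le_rpow_of_exponent_le hx ?_
  nlinarith [sq_nonneg η]

/-- With probability polynomially close to one, at least `n ^ (1 / 2 + α)` of the first `n`
steps start at a new site. -/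
theorem exists_occurrences_bound (d : ℕ) (hd : 2 ≤ d) (K h r : ℝ) (hK : 0 < K) (hh : 0 < h)
    (hr : 0 < r) :
    ∃ α γ C : ℝ, ∃ n₁ : ℕ, 0 < α ∧ α ≤ 1 / 64 ∧ 0 < γ ∧ 0 ≤ C ∧
      ∀ (Ω : Type u) (mΩ : MeasurableSpace Ω) (Q : Measure Ω) [IsProbabilityMeasure Q]
        (𝒢 : Filtration ℕ mΩ) (N : ℕ → Set Ω) (Y : ℕ → Ω → (Fin d → ℤ)),
        IsCenteredOff Q 𝒢 N K h r Y → ∀ k₀ n : ℕ,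
          (∀ ω, (((Finset.range n).image fun j => Y j ω).card : ℝ) ≤ occurrences N n ω + k₀) →
          n₁ ≤ n → (k₀ : ℝ) ≤ (n : ℝ) ^ (1 / 2 + α) →
          Q.real {ω | occurrences N n ω ≤ (n : ℝ) ^ (1 / 2 + α)} ≤ C * (n : ℝ) ^ (-γ) := by
  have hd' : (2 : ℝ) ≤ d := by exact_mod_cast hd
  have hhr : 0 < h * r ^ 2 := by positivity
  -- With `p = 1 - δ` the concavity loss `2 * δ * K ^ 2` is at most `h * r ^ 2 / 8`; the choice of
  -- `s = √B` bounds `K ^ 3 / √B` by the same amount. Of the gain `h * r ^ 2 / 2`, the part `h * r ^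
  -- 2 / 4` is left.
  set δ := min (1 / 2) (h * r ^ 2 / (16 * K ^ 2)) with hδ
  have hδ0 : 0 < δ := lt_min (by norm_num) (by positivity)
  have hδ1 : δ ≤ 1 / 2 := min_le_left _ _
  have hδ2 : δ * (16 * K ^ 2) ≤ h * r ^ 2 := by
    have : δ ≤ h * r ^ 2 / (16 * K ^ 2) := min_le_right _ _
    rwa [le_div_iff₀ (by positivity)] at this
  set s := 1 + 2 * K + 8 * K ^ 3 / (h * r ^ 2) with hs
  have h8 : 0 < 8 * K ^ 3 / (h * r ^ 2) := by positivity
  have hs1 : 1 ≤ s := by linarith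
  have hsK : 2 * K ≤ s := by linarith
  have hs8 : K ^ 3 / s ≤ h * r ^ 2 / 8 := by
    rw [div_le_iff₀ (by linarith)]
    have h9 : 8 * K ^ 3 / (h * r ^ 2) ≤ s := by linarith
    rw [div_le_iff₀ hhr] at h9
    linarith
  have hsB : Real.sqrt (s ^ 2) = s := Real.sqrt_sq (by linarith)
  set η := δ / (2 * d) with hη
  have hη0 : 0 < η := by positivity
  have hη1 : η ≤ 1 / 8 := by rw [hη, div_le_iff₀ (by positivity)]; linarith
  set c₁ := (1 - δ) * s ^ (1 - δ - 2) * (h * r ^ 2 / 4) with hc₁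
  have hc₁0 : 0 < c₁ := by
    have : 0 < s ^ (1 - δ - 2) := Real.rpow_pos_of_pos (by linarith) _
    have : 0 < 1 - δ := by linarith
    positivity
  set C₂ := 3 + K ^ 2 + K + K * (3 ^ d + 1) with hC₂
  have hC₂0 : 0 < C₂ := by positivity
  -- The first threshold on `n` gives `B ≤ n`. The second, `256 = 4 ^ 4`, gives `4 ≤ n ^ (1 / 4)`,
  -- whence `4 * m ≤ n`.
  refine ⟨η / 8, η / 4, 8 * (C₂ / c₁), max ⌈s ^ 2⌉₊ 256, by positivity, by linarith, by positivity,
    by positivity, ?_⟩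
  intro Ω mΩ Q _ 𝒢 N Y H k₀ n hrange hn hk₀
  have hn1 : s ^ 2 ≤ n := (Nat.le_ceil _).trans (by exact_mod_cast (le_max_left _ _).trans hn)
  have hn2 : (256 : ℝ) ≤ n := by exact_mod_cast (le_max_right _ _).trans hn
  have hn0 : (0 : ℝ) < n := by linarith
  set m := (n : ℝ) ^ (1 / 2 + η / 8) with hm
  have hm1 : 1 ≤ m := Real.one_le_rpow (by linarith) (by linarith)
  have hm0 : 0 < m := by linarith
  have hmsqrt : Real.sqrt n ≤ m := by
    rw [Real.sqrt_eq_rpow]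
    exact Real.rpow_le_rpow_of_exponent_le (by linarith) (by linarith)
  have hmn : 4 * m ≤ n := by
    have h1 : (n : ℝ) = m * (n : ℝ) ^ (1 / 2 - η / 8) := by
      rw [hm, ← Real.rpow_add hn0]; norm_num
    have h2 : (4 : ℝ) ≤ (n : ℝ) ^ (1 / 2 - η / 8) := by
      calc (4 : ℝ) = (256 : ℝ) ^ (1 / 4 : ℝ) := by
            rw [show (256 : ℝ) = 4 ^ (4 : ℝ) by norm_num, ← Real.rpow_mul (by norm_num)]; norm_num
        _ ≤ (n : ℝ) ^ (1 / 4 : ℝ) := Real.rpow_le_rpow (by norm_num) hn2 (by norm_num)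
        _ ≤ _ := Real.rpow_le_rpow_of_exponent_le (by linarith) (by linarith)
    have h3 := mul_le_mul_of_nonneg_left h2 hm0.le
    linarith
  have hb : ∀ i ∈ Finset.range n,
      ∑ j ∈ Finset.Ico i n, Q.real ((atMost N m j \ N j) ∩ {ω | Y j ω = Y i ω})
        ≤ C₂ / c₁ * m ^ (1 - η) := by
    intro i hi
    have h1 := H.sum_measureReal_return_le hd hr.le (B := s ^ 2) (p := 1 - δ)
      (c := h * r ^ 2 / 4) (m := m) (by nlinarith) hK.le (by linarith) (by linarith)
      (by rw [hsB]; exact hsK) (by positivity) (by rw [hsB]; nlinarith) hm1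
      (Finset.mem_range.1 hi).le
    have h2 := potential_bound_le (n := (n : ℝ)) hd hK.le (by linarith : 1 / 2 ≤ 1 - δ)
      (by linarith) (by nlinarith : 1 ≤ s ^ 2) hn1 hmsqrt
    rw [hsB, ← hc₁] at h1
    rw [sub_sub_cancel, ← hη, ← hC₂] at h2
    rw [sub_sub_cancel, ← hη] at h1
    rw [div_mul_eq_mul_div, le_div_iff₀ hc₁0, mul_comm]
    exact h1.trans h2
  have h1 := H.measureReal_occurrences_le hm1 hmn hk₀ hrange hb
  have h2 := range_exponent_bound (η := η) (by linarith : (1 : ℝ) ≤ n)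
  rw [← hm] at h2
  refine h1.trans ?_
  have h3 := mul_le_mul_of_nonneg_left h2 (by positivity : 0 ≤ 8 * (C₂ / c₁))
  refine le_trans (le_of_eq ?_) h3
  ring

/-! ### Exponential bound for the fluctuations. -/

theorem exp_neg_le_one_sub_add_sq {x K θ : ℝ} (hx : |x| ≤ K) (hθ : 0 ≤ θ) (hθK : θ * K ≤ 1) :
    Real.exp (-(θ * x)) ≤ 1 - θ * x + θ ^ 2 * K ^ 2 := by
  have h0 : |θ * x| ≤ θ * K := by
    rw [abs_mul, abs_of_nonneg hθ]; exact mul_le_mul_of_nonneg_left hx hθ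
  have h1 := (abs_le.1 (Real.abs_exp_sub_one_sub_id_le (x := -(θ * x))
    (by rw [abs_neg]; exact h0.trans hθK))).2
  have h2 : (θ * x) ^ 2 ≤ (θ * K) ^ 2 := sq_le_sq' (abs_le.1 h0).1 (abs_le.1 h0).2
  nlinarith

section ExponentialBound

variable {Ω : Type*} {mΩ : MeasurableSpace Ω} {Q : Measure Ω} [IsProbabilityMeasure Q]
  {𝒢 : Filtration ℕ mΩ} {ξ v : ℕ → Ω → ℝ} {K : ℝ} {b : ℕ → ℝ}

/-- The integrand is a supermartingale: expand `exp (-(θ * ξ n))` to second order, replace `ξ n` by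
`v n` in the mean, and absorb the result by `1 + x ≤ exp x`. Stating the drift hypothesis with test
functions `W` makes it stable under conditioning on a past event. -/
theorem integral_exp_drift_sub_le_one (hξm : ∀ n, Measurable[𝒢 (n + 1)] (ξ n))
    (hvm : ∀ n, Measurable[𝒢 n] (v n)) (hξ : ∀ n ω, |ξ n ω| ≤ K) (hv0 : ∀ n ω, 0 ≤ v n ω)
    (hvb : ∀ n ω, v n ω ≤ b n)
    (hdrift : ∀ n (W : Ω → ℝ), Measurable[𝒢 n] W → (∀ ω, 0 ≤ W ω) → (∃ c, ∀ ω, W ω ≤ c) →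
      ∫ ω, W ω * v n ω ∂Q ≤ ∫ ω, W ω * ξ n ω ∂Q)
    {θ : ℝ} (hθ : 0 ≤ θ) (hθK : θ * K ≤ 1) (n : ℕ) :
    ∫ ω, Real.exp (∑ i ∈ Finset.range n, (θ * (v i ω - ξ i ω) - θ ^ 2 * K ^ 2)) ∂Q ≤ 1 := by
  induction n with
  | zero => simp
  | succ n ih =>
    refine le_trans ?_ ih
    set U : Ω → ℝ := fun ω =>
      Real.exp (∑ i ∈ Finset.range n, (θ * (v i ω - ξ i ω) - θ ^ 2 * K ^ 2)) with hU
    set W : Ω → ℝ := fun ω => U ω * Real.exp (θ * v n ω - θ ^ 2 * K ^ 2) with hW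
    have hUm : Measurable[𝒢 n] U := by
      refine Real.measurable_exp.comp (Finset.measurable_fun_sum _ fun i hi => ?_)
      have hin := Finset.mem_range.1 hi
      have h1 : Measurable[𝒢 n] (v i) := (hvm i).mono (𝒢.mono hin.le) le_rfl
      have h2 : Measurable[𝒢 n] (ξ i) := (hξm i).mono (𝒢.mono hin) le_rfl
      exact ((h1.sub h2).const_mul θ).sub_const _
    have hWm : Measurable[𝒢 n] W :=
      hUm.mul (Real.measurable_exp.comp (((hvm n).const_mul θ).sub_const _))
    have hU0 : ∀ ω, 0 ≤ U ω := fun ω => (Real.exp_pos _).le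
    have hW0 : ∀ ω, 0 ≤ W ω := fun ω => mul_nonneg (hU0 ω) (Real.exp_pos _).le
    have hUb : ∀ ω, U ω ≤ Real.exp (∑ i ∈ Finset.range n, θ * (b i + K)) := fun ω => by
      refine Real.exp_le_exp.2 (Finset.sum_le_sum fun i _ => ?_)
      have h1 := mul_le_mul_of_nonneg_left
        (by linarith [hvb i ω, (abs_le.1 (hξ i ω)).1] : v i ω - ξ i ω ≤ b i + K) hθ
      have h2 : 0 ≤ θ ^ 2 * K ^ 2 := by positivity
      linarith
    have hWb : ∀ ω, W ω ≤
        Real.exp (∑ i ∈ Finset.range n, θ * (b i + K)) * Real.exp (θ * b n) := fun ω => by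
      refine mul_le_mul (hUb ω) (Real.exp_le_exp.2 ?_) (Real.exp_pos _).le (Real.exp_pos _).le
      have h1 := mul_le_mul_of_nonneg_left (hvb n ω) hθ
      have h2 : 0 ≤ θ ^ 2 * K ^ 2 := by positivity
      linarith
    set c := Real.exp (∑ i ∈ Finset.range n, θ * (b i + K)) * Real.exp (θ * b n)
    have hWm' : Measurable W := hWm.mono (𝒢.le n) le_rfl
    have hξm' : Measurable (ξ n) := (hξm n).mono (𝒢.le _) le_rfl
    have hvm' : Measurable (v n) := (hvm n).mono (𝒢.le _) le_rfl
    have hWi : Integrable W Q := Integrable.of_bound hWm'.aestronglyMeasurable c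
      (ae_of_all _ fun ω => by rw [Real.norm_eq_abs, abs_of_nonneg (hW0 ω)]; exact hWb ω)
    have hUi : Integrable U Q := Integrable.of_bound
      (hUm.mono (𝒢.le n) le_rfl).aestronglyMeasurable _
      (ae_of_all _ fun ω => by rw [Real.norm_eq_abs, abs_of_nonneg (hU0 ω)]; exact hUb ω)
    have hWξ : Integrable (fun ω => W ω * ξ n ω) Q := hWi.mul_bdd (c := K)
      hξm'.aestronglyMeasurable (ae_of_all _ fun ω => hξ n ω)
    have hWv : Integrable (fun ω => W ω * v n ω) Q := hWi.mul_bdd (c := b n)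
      hvm'.aestronglyMeasurable (ae_of_all _ fun ω => by
        rw [Real.norm_eq_abs, abs_of_nonneg (hv0 n ω)]; exact hvb n ω)
    have hd := hdrift n W hWm hW0 ⟨c, hWb⟩
    have hstep : ∀ (f : Ω → ℝ), Integrable (fun ω => W ω * f ω) Q →
        ∫ ω, ((1 + θ ^ 2 * K ^ 2) * W ω - θ * (W ω * f ω)) ∂Q
          = (1 + θ ^ 2 * K ^ 2) * ∫ ω, W ω ∂Q - θ * ∫ ω, W ω * f ω ∂Q := fun f hf => by
      rw [integral_sub (hWi.const_mul _) (hf.const_mul _), integral_const_mul, integral_const_mul]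
    calc ∫ ω, Real.exp (∑ i ∈ Finset.range (n + 1), (θ * (v i ω - ξ i ω) - θ ^ 2 * K ^ 2)) ∂Q
        = ∫ ω, W ω * Real.exp (-(θ * ξ n ω)) ∂Q := by
          congr 1; ext ω
          rw [Finset.sum_range_succ, hW, hU]
          simp only
          rw [← Real.exp_add, ← Real.exp_add]
          congr 1; ring
      _ ≤ ∫ ω, ((1 + θ ^ 2 * K ^ 2) * W ω - θ * (W ω * ξ n ω)) ∂Q := by
          refine integral_mono_of_nonneg
            (ae_of_all _ fun ω => mul_nonneg (hW0 ω) (Real.exp_pos _).le)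
            ((hWi.const_mul _).sub (hWξ.const_mul _)) (ae_of_all _ fun ω => ?_)
          have := mul_le_mul_of_nonneg_left (exp_neg_le_one_sub_add_sq (hξ n ω) hθ hθK) (hW0 ω)
          simp only
          linarith
      _ ≤ ∫ ω, ((1 + θ ^ 2 * K ^ 2) * W ω - θ * (W ω * v n ω)) ∂Q := by
          rw [hstep _ hWξ, hstep _ hWv]
          have := mul_le_mul_of_nonneg_left hd hθ
          linarith
      _ ≤ ∫ ω, U ω ∂Q := by
          refine integral_mono ((hWi.const_mul _).sub (hWv.const_mul _)) hUi fun ω => ?_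
          have h1 := Real.add_one_le_exp (-(θ * v n ω - θ ^ 2 * K ^ 2))
          have h2 : U ω = W ω * Real.exp (-(θ * v n ω - θ ^ 2 * K ^ 2)) := by
            rw [hW]; simp only
            rw [mul_assoc, ← Real.exp_add]; simp
          rw [h2]
          have := mul_le_mul_of_nonneg_left h1 (hW0 ω)
          linarith

theorem measureReal_sum_le_sub_le (hξm : ∀ n, Measurable[𝒢 (n + 1)] (ξ n))
    (hvm : ∀ n, Measurable[𝒢 n] (v n)) (hξ : ∀ n ω, |ξ n ω| ≤ K) (hv0 : ∀ n ω, 0 ≤ v n ω)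
    (hvb : ∀ n ω, v n ω ≤ b n)
    (hdrift : ∀ n (W : Ω → ℝ), Measurable[𝒢 n] W → (∀ ω, 0 ≤ W ω) → (∃ c, ∀ ω, W ω ≤ c) →
      ∫ ω, W ω * v n ω ∂Q ≤ ∫ ω, W ω * ξ n ω ∂Q)
    {θ : ℝ} (hθ : 0 ≤ θ) (hθK : θ * K ≤ 1) (n : ℕ) (x : ℝ) :
    Q.real {ω | ∑ i ∈ Finset.range n, ξ i ω ≤ ∑ i ∈ Finset.range n, v i ω - x}
      ≤ Real.exp (-(θ * x) + n * (θ ^ 2 * K ^ 2)) := by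
  set U : Ω → ℝ := fun ω =>
    Real.exp (∑ i ∈ Finset.range n, (θ * (v i ω - ξ i ω) - θ ^ 2 * K ^ 2)) with hU
  have h1 := integral_exp_drift_sub_le_one hξm hvm hξ hv0 hvb hdrift hθ hθK n
  have hUm : Measurable U := by
    refine Real.measurable_exp.comp (Finset.measurable_fun_sum _ fun i _ => ?_)
    have h1 : Measurable (v i) := (hvm i).mono (𝒢.le _) le_rfl
    have h2 : Measurable (ξ i) := (hξm i).mono (𝒢.le _) le_rfl
    exact ((h1.sub h2).const_mul θ).sub_const _
  have hUi : Integrable U Q := by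
    refine Integrable.of_bound hUm.aestronglyMeasurable
      (Real.exp (∑ i ∈ Finset.range n, θ * (b i + K))) (ae_of_all _ fun ω => ?_)
    rw [Real.norm_eq_abs, abs_of_pos (Real.exp_pos _)]
    refine Real.exp_le_exp.2 (Finset.sum_le_sum fun i _ => ?_)
    have h1 := mul_le_mul_of_nonneg_left
      (by linarith [hvb i ω, (abs_le.1 (hξ i ω)).1] : v i ω - ξ i ω ≤ b i + K) hθ
    have h2 : 0 ≤ θ ^ 2 * K ^ 2 := by positivity
    linarith
  have h2 := mul_meas_ge_le_integral_of_nonneg (ae_of_all Q fun ω => (Real.exp_pos _).le) hUi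
    (Real.exp (θ * x - n * (θ ^ 2 * K ^ 2)))
  have h3 : {ω | ∑ i ∈ Finset.range n, ξ i ω ≤ ∑ i ∈ Finset.range n, v i ω - x}
      ⊆ {ω | Real.exp (θ * x - n * (θ ^ 2 * K ^ 2)) ≤ U ω} := by
    intro ω hω
    refine Real.exp_le_exp.2 ?_
    rw [Finset.sum_sub_distrib, ← Finset.mul_sum, Finset.sum_sub_distrib, Finset.sum_const,
      Finset.card_range, nsmul_eq_mul]
    have hω' : x ≤ ∑ i ∈ Finset.range n, v i ω - ∑ i ∈ Finset.range n, ξ i ω := by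
      have : ∑ i ∈ Finset.range n, ξ i ω ≤ ∑ i ∈ Finset.range n, v i ω - x := hω
      linarith
    have := mul_le_mul_of_nonneg_left hω' hθ
    linarith
  have h4 := (mul_le_mul_of_nonneg_left (measureReal_mono (μ := Q) h3)
    (Real.exp_pos (θ * x - n * (θ ^ 2 * K ^ 2))).le).trans (h2.trans h1)
  have h5 : -(θ * x) + n * (θ ^ 2 * K ^ 2) = -(θ * x - n * (θ ^ 2 * K ^ 2)) := by ring
  rw [h5, Real.exp_neg, ← one_div, le_div_iff₀ (Real.exp_pos _)]
  linarith

/-- The previous bound with an optimized exponent, for fluctuations of order `t ^ (1 / 2 + ε)`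
up to time `t`. -/
theorem measureReal_sum_le_sub_rpow_le (hξm : ∀ n, Measurable[𝒢 (n + 1)] (ξ n))
    (hvm : ∀ n, Measurable[𝒢 n] (v n)) (hξ : ∀ n ω, |ξ n ω| ≤ K) (hv0 : ∀ n ω, 0 ≤ v n ω)
    (hvb : ∀ n ω, v n ω ≤ b n)
    (hdrift : ∀ n (W : Ω → ℝ), Measurable[𝒢 n] W → (∀ ω, 0 ≤ W ω) → (∃ c, ∀ ω, W ω ≤ c) →
      ∫ ω, W ω * v n ω ∂Q ≤ ∫ ω, W ω * ξ n ω ∂Q)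
    (hK : 0 < K) {ε t : ℝ} (ht : 0 < t) (htK : t ^ (ε - 1 / 2) ≤ 2 * K) {n : ℕ} (hn : n ≤ t) :
    Q.real {ω | ∑ i ∈ Finset.range n, ξ i ω ≤ ∑ i ∈ Finset.range n, v i ω - t ^ (1 / 2 + ε)}
      ≤ Real.exp (-(t ^ (2 * ε) / (4 * K ^ 2))) := by
  have hpos : 0 < t ^ (ε - 1 / 2) := Real.rpow_pos_of_pos ht _
  refine (measureReal_sum_le_sub_le hξm hvm hξ hv0 hvb hdrift
    -- This value minimizes `-(θ * x) + t * θ ^ 2 * K ^ 2` for `x = t ^ (1 / 2 + ε)`; the hypothesis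
    -- `htK` is then exactly `θ * K ≤ 1`.
    (θ := t ^ (ε - 1 / 2) / (2 * K ^ 2)) (by positivity) ?_ n _).trans (Real.exp_le_exp.2 ?_)
  · rw [div_mul_eq_mul_div, div_le_one (by positivity)]; nlinarith
  · have h1 : t ^ (ε - 1 / 2) * t ^ (1 / 2 + ε) = t ^ (2 * ε) := by
      rw [← Real.rpow_add ht]; ring_nf
    have h2 : t * (t ^ (ε - 1 / 2)) ^ 2 = t ^ (2 * ε) := by
      rw [← Real.rpow_natCast, ← Real.rpow_mul ht.le]
      nth_rewrite 1 [← Real.rpow_one t]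
      rw [← Real.rpow_add ht]
      congr 1; push_cast; ring
    have h3 : (n : ℝ) * ((t ^ (ε - 1 / 2) / (2 * K ^ 2)) ^ 2 * K ^ 2)
        ≤ t * ((t ^ (ε - 1 / 2) / (2 * K ^ 2)) ^ 2 * K ^ 2) :=
      mul_le_mul_of_nonneg_right hn (by positivity)
    have h4 : t * ((t ^ (ε - 1 / 2) / (2 * K ^ 2)) ^ 2 * K ^ 2) = t ^ (2 * ε) / (4 * K ^ 2) := by
      rw [← h2]; field_simp; norm_num
    have h5 : t ^ (ε - 1 / 2) / (2 * K ^ 2) * t ^ (1 / 2 + ε) = 2 * (t ^ (2 * ε) / (4 * K ^ 2)) := by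
      rw [div_mul_eq_mul_div, h1]; field_simp; norm_num
    linarith

end ExponentialBound

/-- If the fluctuations of `S` are small and the number of times in `N` is large, at all dyadic
scales above `2 ^ κ`, then `S` stays positive and tends to infinity. -/
theorem tendsto_atTop_of_dyadic_bounds {S ν : ℕ → ℝ} {N : ℕ → Prop} [DecidablePred N]
    {κ : ℕ} {a e : ℝ} (he : 0 < e) (hν : Antitone ν) (hν0 : ∀ i, 0 ≤ ν i)
    (hS0 : 2 * ((2 : ℝ) ^ κ) ^ e ≤ S 0)
    (hfluct : ∀ j : ℕ, (∑ i ∈ Finset.range j, if N i ∧ 0 < S i then ν i else 0)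
      - (max (j : ℝ) (2 ^ κ)) ^ e ≤ S j - S 0)
    (hcount : ∀ k, κ ≤ k → ((2 : ℝ) ^ k) ^ a ≤ ∑ i ∈ Finset.range (2 ^ k), if N i then (1 : ℝ) else 0)
    (hgain : ∀ k, κ ≤ k → 2 * ((2 : ℝ) ^ (k + 1)) ^ e ≤ ν (2 ^ k) * ((2 : ℝ) ^ k) ^ a) :
    Tendsto S atTop atTop := by
  have key : ∀ j : ℕ, (max (j : ℝ) (2 ^ κ)) ^ e ≤ S j := by
    intro j
    induction j using Nat.strong_induction_on with
    | _ j ih =>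
      have hT0 : (0 : ℝ) < 2 ^ κ := by positivity
      have hpos : ∀ i < j, 0 < S i := fun i hi =>
        (Real.rpow_pos_of_pos (lt_of_lt_of_le hT0 (le_max_right _ _)) _).trans_le (ih i hi)
      have hf := hfluct j
      have hterm : ∀ i, 0 ≤ (if N i ∧ 0 < S i then ν i else 0) := fun i => by
        split_ifs
        exacts [hν0 i, le_rfl]
      -- Up to time `2 ^ κ` no gain is needed: the fluctuation uses at most half of the initial
      -- height.
      rcases le_or_gt j (2 ^ κ) with hj | hj
      · have hmax : max (j : ℝ) (2 ^ κ) = 2 ^ κ := max_eq_right (by exact_mod_cast hj)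
        rw [hmax] at hf ⊢
        have := Finset.sum_nonneg fun i (_ : i ∈ Finset.range j) => hterm i
        linarith
      · have hmax : max (j : ℝ) (2 ^ κ) = j := max_eq_left (by exact_mod_cast hj.le)
        rw [hmax] at hf ⊢
        -- All times before `2 ^ k` precede `j`, so by induction the walk was positive then and
        -- every new site counted by `hcount` carried drift. This gain is twice the fluctuation
        -- allowed at `2 ^ (k + 1) ≥ j`.
        obtain ⟨k, hk1, hk2⟩ : ∃ k, 2 ^ k < j ∧ j ≤ 2 ^ (k + 1) := by
          have hj1 : 1 < j := lt_of_le_of_lt Nat.one_le_two_pow hj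
          refine ⟨Nat.clog 2 j - 1, Nat.pow_pred_clog_lt_self (by norm_num) hj1, ?_⟩
          rw [Nat.sub_add_cancel (Nat.clog_pos (by norm_num) hj1)]
          exact Nat.le_pow_clog (by norm_num) j
        have hκk : κ ≤ k := by
          by_contra hlt
          have := Nat.pow_le_pow_right (n := 2) (by norm_num) (by omega : k + 1 ≤ κ)
          omega
        have h1 : ν (2 ^ k) * ((2 : ℝ) ^ k) ^ a
            ≤ ∑ i ∈ Finset.range j, if N i ∧ 0 < S i then ν i else 0 := by
          calc _ ≤ ν (2 ^ k) * ∑ i ∈ Finset.range (2 ^ k), (if N i then (1 : ℝ) else 0) :=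
                mul_le_mul_of_nonneg_left (hcount k hκk) (hν0 _)
            _ = ∑ i ∈ Finset.range (2 ^ k), (if N i then ν (2 ^ k) else 0) := by
                rw [Finset.mul_sum]
                exact Finset.sum_congr rfl fun i _ => by split_ifs <;> simp
            _ ≤ ∑ i ∈ Finset.range (2 ^ k), (if N i ∧ 0 < S i then ν i else 0) := by
                refine Finset.sum_le_sum fun i hi => ?_
                have hi' := Finset.mem_range.1 hi
                have := hpos i (hi'.trans hk1)
                by_cases hN : N i
                · rw [if_pos hN, if_pos ⟨hN, this⟩]; exact hν hi'.le
                · rw [if_neg hN, if_neg fun h => hN h.1]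
            _ ≤ _ := Finset.sum_le_sum_of_subset_of_nonneg
                (Finset.range_mono hk1.le) fun i _ _ => hterm i
        have h2 := hgain k hκk
        have h3 : (j : ℝ) ^ e ≤ ((2 : ℝ) ^ (k + 1)) ^ e :=
          Real.rpow_le_rpow (Nat.cast_nonneg j) (by exact_mod_cast hk2) he.le
        have h4 : 0 ≤ ((2 : ℝ) ^ κ) ^ e := by positivity
        linarith
  refine tendsto_atTop_mono (f := fun j : ℕ => (j : ℝ) ^ e) (fun j => le_trans ?_ (key j))
    ((tendsto_rpow_atTop he).comp tendsto_natCast_atTop_atTop)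
  exact Real.rpow_le_rpow (Nat.cast_nonneg j) (le_max_left _ _) he.le

/-- The filtration `n ↦ ℱ (k₀ + n)`. -/
def shiftFiltration {Ω : Type*} {mΩ : MeasurableSpace Ω} (ℱ : Filtration ℕ mΩ) (k₀ : ℕ) :
    Filtration ℕ mΩ where
  seq n := ℱ (k₀ + n)
  mono' _ _ hij := ℱ.mono (Nat.add_le_add_left hij k₀)
  le' n := ℱ.le (k₀ + n)

/-- The event that `X` is at a new site at time `k₀ + n`. -/
def newSite {Ω α : Type*} (X : ℕ → Ω → α) (k₀ n : ℕ) : Set Ω :=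
  {ω | ∀ k < k₀ + n, X k ω ≠ X (k₀ + n) ω}

/-- A site seen after time `k₀` is either new when first met there or among the at most `k₀` sites
visited before. -/
theorem card_image_range_le_occurrences {Ω α : Type*} [DecidableEq α] (X : ℕ → Ω → α) (k₀ n : ℕ)
    (ω : Ω) : (((Finset.range n).image fun j => X (k₀ + j) ω).card : ℝ)
      ≤ occurrences (newSite X k₀) n ω + k₀ := by
  have h1 : (((Finset.range (k₀ + n)).image fun j => X j ω).card : ℝ)
      ≤ occurrences (newSite X k₀) n ω + k₀ := by
    induction n with
    | zero =>
      have : ((Finset.range k₀).image fun j => X j ω).card ≤ k₀ := by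
        simpa using Finset.card_image_le (s := Finset.range k₀) (f := fun j => X j ω)
      simpa [occurrences] using this
    | succ n ih =>
      rw [← add_assoc, Finset.range_add_one, Finset.image_insert, occurrences_succ]
      by_cases hω : ω ∈ newSite X k₀ n
      · rw [Set.indicator_of_mem hω]
        have : ((insert (X (k₀ + n) ω) ((Finset.range (k₀ + n)).image fun j => X j ω)).card : ℝ)
            ≤ ((Finset.range (k₀ + n)).image fun j => X j ω).card + 1 := by
          exact_mod_cast Finset.card_insert_le _ _
        linarith
      · rw [Set.indicator_of_notMem hω, add_zero, Finset.insert_eq_of_mem]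
        · exact ih
        · simp only [newSite, Set.mem_ofPred_eq, not_forall, not_not] at hω
          obtain ⟨k, hk, hkn⟩ := hω
          exact Finset.mem_image.2 ⟨k, Finset.mem_range.2 hk, hkn⟩
  refine le_trans ?_ h1
  norm_cast
  refine Finset.card_le_card fun x hx => ?_
  obtain ⟨j, hj, rfl⟩ := Finset.mem_image.1 hx
  exact Finset.mem_image.2 ⟨k₀ + j, Finset.mem_range.2
    (Nat.add_lt_add_left (Finset.mem_range.1 hj) k₀), rfl⟩

/-! ### The excited walk conditioned on its past. -/

section Cond

variable {Ω : Type*} {mΩ : MeasurableSpace Ω} {P : Measure Ω} {G : Set Ω}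

theorem integral_cond_eq (f : Ω → ℝ) :
    ∫ ω, f ω ∂P[|G] = (P.real G)⁻¹ * ∫ ω in G, f ω ∂P := by
  rw [ProbabilityTheory.cond, integral_smul_measure, ENNReal.toReal_inv, smul_eq_mul]
  rfl

theorem setIntegral_cond_eq {A : Set Ω} (hA : MeasurableSet A) (f : Ω → ℝ) :
    ∫ ω in A, f ω ∂P[|G] = (P.real G)⁻¹ * ∫ ω in A ∩ G, f ω ∂P := by
  rw [ProbabilityTheory.cond, Measure.restrict_smul, integral_smul_measure, ENNReal.toReal_inv,
    smul_eq_mul, Measure.restrict_restrict hA]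
  rfl

theorem measureReal_cond_eq (hG : MeasurableSet G) (A : Set Ω) :
    P[|G].real A = (P.real G)⁻¹ * P.real (G ∩ A) := by
  rw [measureReal_def, cond_apply hG, ENNReal.toReal_mul, ENNReal.toReal_inv]
  rfl

end Cond

namespace IsGERW

variable {d : ℕ} {Ω : Type*} {mΩ : MeasurableSpace Ω} {P : Measure Ω}
  {ℱ : Filtration ℕ mΩ} {lam : ℕ → ℝ} {ℓ : EuclideanSpace ℝ (Fin d)} {A : Set (Fin d → ℤ)}
  {K h r : ℝ} {X : ℕ → Ω → (Fin d → ℤ)}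

theorem measurable_increment (H : IsGERW P ℱ lam ℓ A K h r X) (n : ℕ) :
    Measurable[ℱ (n + 1)] (increment X n) := by
  have h1 : ∀ f : (Fin d → ℤ) × (Fin d → ℤ) → EuclideanSpace ℝ (Fin d), Measurable f :=
    fun f => Measurable.of_discrete
  have hX : Measurable[ℱ (n + 1)] (X n) := (H.adapted n).mono (ℱ.mono (Nat.le_succ n)) le_rfl
  exact (h1 fun x => latticePoint x.1 - latticePoint x.2).comp ((H.adapted (n + 1)).prodMk hX)

theorem measurable_inner_increment (H : IsGERW P ℱ lam ℓ A K h r X) (n : ℕ)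
    (v : EuclideanSpace ℝ (Fin d)) :
    Measurable[ℱ (n + 1)] fun ω => inner ℝ (increment X n ω) v :=
  (H.measurable_increment n).inner_const

theorem abs_inner_increment_le (H : IsGERW P ℱ lam ℓ A K h r X) (n : ℕ) (ω : Ω) :
    |inner ℝ (increment X n ω) ℓ| ≤ K := by
  have := abs_real_inner_le_norm (increment X n ω) ℓ
  rw [H.norm_direction, mul_one] at this
  exact this.trans (H.bounded n ω).le

theorem measurable_inner_latticePoint (H : IsGERW P ℱ lam ℓ A K h r X) (n : ℕ) :
    Measurable[ℱ n] fun ω => (inner ℝ (latticePoint (X n ω)) ℓ : ℝ) := by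
  have h1 : ∀ f : (Fin d → ℤ) → ℝ, Measurable f := fun f => Measurable.of_discrete
  exact (h1 fun x => inner ℝ (latticePoint x) ℓ).comp (H.adapted n)

theorem measurableSet_newSite (H : IsGERW P ℱ lam ℓ A K h r X) (k₀ n : ℕ) :
    MeasurableSet[ℱ (k₀ + n)] (newSite X k₀ n) := by
  have : newSite X k₀ n = ⋂ k ∈ Set.Iio (k₀ + n), {ω | X k ω = X (k₀ + n) ω}ᶜ := by
    ext ω; simp [newSite]
  rw [this]
  refine MeasurableSet.biInter (Set.to_countable _) fun k hk => MeasurableSet.compl ?_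
  have hX : Measurable[ℱ (k₀ + n)] (X k) :=
    (H.adapted k).mono (ℱ.mono (le_of_lt hk)) le_rfl
  have hD : MeasurableSet {p : (Fin d → ℤ) × (Fin d → ℤ) | p.1 = p.2} := MeasurableSet.of_discrete
  exact (hX.prodMk (H.adapted (k₀ + n))) hD

theorem drift_eq_zero_of_not_newSite (H : IsGERW P ℱ lam ℓ A K h r X) (k₀ n : ℕ) :
    ∀ᵐ ω ∂P, ω ∉ newSite X k₀ n → drift P ℱ X (k₀ + n) ω = 0 := by
  filter_upwards [H.drift_zero (k₀ + n)] with ω hω hN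
  refine hω (Or.inl ?_)
  simpa [newSite] using hN

theorem measurableSet_forall_jump (H : IsGERW P ℱ lam ℓ A K h r X) (k : ℕ) :
    MeasurableSet[ℱ k] {ω | ∀ i < k, r < inner ℝ (increment X i ω) ℓ} := by
  have : {ω | ∀ i < k, r < inner ℝ (increment X i ω) ℓ}
      = ⋂ i ∈ Set.Iio k, {ω | r < inner ℝ (increment X i ω) ℓ} := by ext ω; simp
  rw [this]
  refine MeasurableSet.biInter (Set.to_countable _) fun i hi => ?_
  exact ℱ.mono (Nat.succ_le_of_lt hi) _ (H.measurable_inner_increment i ℓ measurableSet_Ioi)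

variable [IsProbabilityMeasure P]

theorem integrable_increment (H : IsGERW P ℱ lam ℓ A K h r X) (n : ℕ) :
    Integrable (increment X n) P :=
  Integrable.of_bound ((H.measurable_increment n).mono (ℱ.le _) le_rfl).aestronglyMeasurable K
    (ae_of_all _ fun ω => (H.bounded n ω).le)

/-- Conditionally on an event of `ℱ k₀`, the process after time `k₀` is centered and elliptic at
visited sites. -/
theorem isCenteredOff (H : IsGERW P ℱ lam ℓ A K h r X) {k₀ : ℕ} {G : Set Ω}
    (hG : MeasurableSet[ℱ k₀] G) :
    IsCenteredOff P[|G] (shiftFiltration ℱ k₀) (newSite X k₀) K h r fun n => X (k₀ + n) where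
  adapted n := H.adapted (k₀ + n)
  measurableSet_new n := H.measurableSet_newSite k₀ n
  bounded n ω := (H.bounded (k₀ + n) ω).le
  ne_of_new n ω hω k hk := hω (k₀ + k) (Nat.add_lt_add_left hk k₀)
  centered n B hB hBN w := by
    have hGn : MeasurableSet[ℱ (k₀ + n)] G := ℱ.mono (Nat.le_add_right k₀ n) _ hG
    have hBm : MeasurableSet[ℱ (k₀ + n)] B := hB
    have hBG : MeasurableSet[ℱ (k₀ + n)] (B ∩ G) := hBm.inter hGn
    have h1 : ∫ ω in B ∩ G, increment X (k₀ + n) ω ∂P = 0 := by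
      rw [← setIntegral_condExp (ℱ.le (k₀ + n)) (H.integrable_increment (k₀ + n)) hBG]
      refine setIntegral_eq_zero_of_ae_eq_zero ?_
      filter_upwards [H.drift_eq_zero_of_not_newSite k₀ n] with ω hω hωB
      exact hω (Set.disjoint_left.1 hBN hωB.1)
    rw [setIntegral_cond_eq (ℱ.le _ _ hBm)]
    have h2 : ∫ ω in B ∩ G, inner ℝ w (increment X (k₀ + n) ω) ∂P = 0 := by
      rw [integral_inner (H.integrable_increment (k₀ + n)).integrableOn, h1, inner_zero_right]
    have h3 : ∀ ω, increment (fun n => X (k₀ + n)) n ω = increment X (k₀ + n) ω := fun ω => rfl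
    simp only [h3]
    rw [h2, mul_zero]
  elliptic n B hB hBN v hv := by
    have hGn : MeasurableSet[ℱ (k₀ + n)] G := ℱ.mono (Nat.le_add_right k₀ n) _ hG
    have hBm : MeasurableSet[ℱ (k₀ + n)] B := hB
    have hBG : MeasurableSet[ℱ (k₀ + n)] (G ∩ B) := hGn.inter hBm
    have hGm : MeasurableSet G := ℱ.le _ _ hG
    have h3 : ∀ ω, increment (fun n => X (k₀ + n)) n ω = increment X (k₀ + n) ω := fun ω => rfl
    simp only [h3]
    set J : Set Ω := {ω | r < inner ℝ (increment X (k₀ + n) ω) v}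
    have hJ : MeasurableSet J := measurableSet_lt measurable_const
      ((H.measurable_inner_increment (k₀ + n) v).mono (ℱ.le _) le_rfl)
    rw [measureReal_cond_eq hGm, measureReal_cond_eq hGm, mul_left_comm]
    refine mul_le_mul_of_nonneg_left ?_ (inv_nonneg.2 measureReal_nonneg)
    have hJi : Integrable (J.indicator fun _ => (1 : ℝ)) P := (integrable_const _).indicator hJ
    calc h * P.real (G ∩ B) = ∫ _ in G ∩ B, h ∂P := by
          rw [setIntegral_const, smul_eq_mul, mul_comm]
      _ ≤ ∫ ω in G ∩ B, condProbJump P ℱ X r v (k₀ + n) ω ∂P := by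
          refine setIntegral_mono_on_ae (integrable_const _) integrable_condExp.integrableOn
            (ℱ.le _ _ hBG) ?_
          filter_upwards [H.drift_eq_zero_of_not_newSite k₀ n,
            H.elliptic_zero_drift (k₀ + n) v hv] with ω h4 h5 hω
          exact h5 (h4 (Set.disjoint_left.1 hBN hω.2))
      _ = ∫ ω in G ∩ B, J.indicator (fun _ => (1 : ℝ)) ω ∂P :=
          setIntegral_condExp (ℱ.le (k₀ + n)) hJi hBG
      _ = P.real (G ∩ (B ∩ J)) := by
          rw [setIntegral_indicator hJ, setIntegral_const, smul_eq_mul, mul_one, Set.inter_assoc]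

/-- The mean increment in the direction `ℓ`, tested against the past, dominates the excitation. -/
theorem integral_mul_le_integral_mul_increment (H : IsGERW P ℱ lam ℓ A K h r X)
    (hA : positiveHalfSpace ℓ ⊆ A) {n : ℕ} {c : ℝ} (hc : c ≤ lam n) {W : Ω → ℝ}
    (hWm : Measurable[ℱ n] W) (hW0 : ∀ ω, 0 ≤ W ω) {b : ℝ} (hWb : ∀ ω, W ω ≤ b) :
    ∫ ω, W ω * (newSite X n 0 ∩ {ω | 0 < (inner ℝ (latticePoint (X n ω)) ℓ : ℝ)}).indicator
        (fun _ => c) ω ∂P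
      ≤ ∫ ω, W ω * inner ℝ (increment X n ω) ℓ ∂P := by
  set S := newSite X n 0 ∩ {ω | 0 < (inner ℝ (latticePoint (X n ω)) ℓ : ℝ)} with hS
  have hSm : MeasurableSet S := by
    refine (ℱ.le _ _ (H.measurableSet_newSite n 0)).inter ?_
    exact measurableSet_lt measurable_const
      ((H.measurable_inner_latticePoint n).mono (ℱ.le n) le_rfl)
  set f : Ω → ℝ := fun ω => inner ℝ (increment X n ω) ℓ with hf
  have hWm' : Measurable W := hWm.mono (ℱ.le n) le_rfl
  have hWabs : ∀ ω, ‖W ω‖ ≤ b := fun ω => by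
    rw [Real.norm_eq_abs, abs_of_nonneg (hW0 ω)]; exact hWb ω
  have hfi : Integrable f P := (H.integrable_increment n).inner_const ℓ
  have hWi : Integrable W P := Integrable.of_bound hWm'.aestronglyMeasurable b
    (ae_of_all _ hWabs)
  have h1 : P[W * f | ℱ n] =ᵐ[P] W * P[f | ℱ n] :=
    condExp_stronglyMeasurable_mul_of_bound (ℱ.le n) hWm.stronglyMeasurable hfi b
      (ae_of_all _ hWabs)
  have h2 : P[f | ℱ n] =ᵐ[P] fun ω => inner ℝ (drift P ℱ X n ω) ℓ := by
    have h3 := ContinuousLinearMap.comp_condExp_comm (m := ℱ n) (H.integrable_increment n)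
      (innerSL ℝ ℓ)
    have h4 : (⇑(innerSL ℝ ℓ) ∘ increment X n) = f := by
      ext ω; simp [hf, real_inner_comm]
    rw [h4] at h3
    filter_upwards [h3] with ω hω
    rw [← hω]
    simp [drift, real_inner_comm]
  have h5 : ∫ ω, W ω * f ω ∂P = ∫ ω, W ω * inner ℝ (drift P ℱ X n ω) ℓ ∂P := by
    rw [← integral_condExp (ℱ.le n) (f := fun ω => W ω * f ω)]
    refine integral_congr_ae ?_
    filter_upwards [h1, h2] with ω h6 h7
    rw [← h7]; exact h6
  rw [h5]
  have hDi : Integrable (fun ω => inner ℝ (drift P ℱ X n ω) ℓ) P :=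
    integrable_condExp.congr h2
  have hWD : Integrable (fun ω => W ω * inner ℝ (drift P ℱ X n ω) ℓ) P :=
    hDi.bdd_mul hWm'.aestronglyMeasurable (ae_of_all _ hWabs)
  have hWc : Integrable (fun ω => W ω * S.indicator (fun _ => c) ω) P :=
    ((integrable_const c).indicator hSm).bdd_mul hWm'.aestronglyMeasurable (ae_of_all _ hWabs)
  refine integral_mono_ae hWc hWD ?_
  filter_upwards [H.drift_excited n, H.drift_zero n] with ω h6 h7
  refine mul_le_mul_of_nonneg_left ?_ (hW0 ω)
  by_cases hω : ω ∈ S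
  · rw [Set.indicator_of_mem hω]
    exact hc.trans (h6 hω.1 (hA hω.2))
  · rw [Set.indicator_of_notMem hω]
    -- Outside the half-space the drift may still be excited, but its component along `ℓ` is never
    -- negative: positive at new sites of `A`, zero elsewhere.
    by_cases hN : ∀ k < n, X k ω ≠ X n ω
    · by_cases hXA : X n ω ∈ A
      · exact (H.lam_pos n).le.trans (h6 hN hXA)
      · rw [h7 (Or.inr ⟨hN, hXA⟩), inner_zero_left]
    · push Not at hN
      rw [h7 (Or.inl hN), inner_zero_left]

/-- Ellipticity along `ℓ` holds at every site, new or old, so each further jump costs at most a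
factor `h`. -/
theorem measureReal_forall_jump_pos (H : IsGERW P ℱ lam ℓ A K h r X) (k : ℕ) :
    0 < P.real {ω | ∀ i < k, r < inner ℝ (increment X i ω) ℓ} := by
  induction k with
  | zero => simp
  | succ k ih =>
    set G := {ω | ∀ i < k, r < inner ℝ (increment X i ω) ℓ} with hG
    set J : Set Ω := {ω | r < inner ℝ (increment X k ω) ℓ} with hJ
    have hJm : MeasurableSet J := ℱ.le _ _ (H.measurable_inner_increment k ℓ measurableSet_Ioi)
    have hGm := H.measurableSet_forall_jump k
    have h1 : {ω | ∀ i < k + 1, r < inner ℝ (increment X i ω) ℓ} = G ∩ J := by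
      ext ω
      simp only [Set.mem_ofPred_eq, Set.mem_inter_iff, hG, hJ]
      constructor
      · exact fun hω => ⟨fun i hi => hω i (by omega), hω k (by omega)⟩
      · rintro ⟨h2, h3⟩ i hi
        rcases Nat.lt_succ_iff_lt_or_eq.1 hi with hik | rfl
        exacts [h2 i hik, h3]
    rw [h1]
    have hJi : Integrable (J.indicator fun _ => (1 : ℝ)) P := (integrable_const _).indicator hJm
    calc 0 < h * P.real G := mul_pos H.h_pos ih
      _ = ∫ _ in G, h ∂P := by rw [setIntegral_const, smul_eq_mul, mul_comm]
      _ ≤ ∫ ω in G, condProbJump P ℱ X r ℓ k ω ∂P := by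
          refine setIntegral_mono_ae (integrable_const _) integrable_condExp.integrableOn ?_
          filter_upwards [H.elliptic_direction k] with ω hω using hω
      _ = ∫ ω in G, J.indicator (fun _ => (1 : ℝ)) ω ∂P :=
          setIntegral_condExp (ℱ.le k) hJi hGm
      _ = P.real (G ∩ J) := by
          rw [setIntegral_indicator hJm, setIntegral_const, smul_eq_mul, mul_one]

end IsGERW

theorem measure_iUnion_le_ofReal_tsum {Ω : Type*} {mΩ : MeasurableSpace Ω} {Q : Measure Ω}
    [IsFiniteMeasure Q] {s : ℕ → Set Ω} {a : ℕ → ℝ} (hs : ∀ k, Q.real (s k) ≤ a k)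
    (ha : Summable a) : Q (⋃ k, s k) ≤ ENNReal.ofReal (∑' k, a k) := by
  rw [ENNReal.ofReal_tsum_of_nonneg (fun k => measureReal_nonneg.trans (hs k)) ha]
  refine (measure_iUnion_le s).trans (ENNReal.tsum_le_tsum fun k => ?_)
  rw [← ofReal_measureReal]
  exact ENNReal.ofReal_le_ofReal (hs k)

namespace IsGERW

variable {d : ℕ} {Ω : Type*} {mΩ : MeasurableSpace Ω} {P : Measure Ω}
  {ℱ : Filtration ℕ mΩ} {lam : ℕ → ℝ} {ℓ : EuclideanSpace ℝ (Fin d)} {A : Set (Fin d → ℤ)}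
  {K h r : ℝ} {X : ℕ → Ω → (Fin d → ℤ)}

theorem mul_le_inner_of_forall_jump (H : IsGERW P ℱ lam ℓ A K h r X) {k : ℕ} {ω : Ω}
    (hω : ∀ i < k, r < inner ℝ (increment X i ω) ℓ) :
    r * k ≤ inner ℝ (latticePoint (X k ω)) ℓ := by
  induction k with
  | zero => simp [H.start, latticePoint_zero]
  | succ k ih =>
    have h1 := ih fun i hi => hω i (by omega)
    have h2 := hω k (by omega)
    rw [increment, inner_sub_left] at h2
    push_cast
    linarith

variable [IsProbabilityMeasure P]

theorem measureReal_cond_fluctuation_le (H : IsGERW P ℱ lam ℓ A K h r X)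
    (hA : positiveHalfSpace ℓ ⊆ A) {k₀ : ℕ} {G : Set Ω} (hG : MeasurableSet[ℱ k₀] G)
    (hPG : P G ≠ 0) {ν : ℕ → ℝ} (hν0 : ∀ i, 0 ≤ ν i) (hν : ∀ i, ν i ≤ lam (k₀ + i))
    {ε t : ℝ} (ht : 0 < t) (htK : t ^ (ε - 1 / 2) ≤ 2 * K) {n : ℕ} (hn : n ≤ t) :
    P[|G].real {ω | ∑ i ∈ Finset.range n, inner ℝ (increment X (k₀ + i) ω) ℓ
      ≤ ∑ i ∈ Finset.range n, (newSite X k₀ i ∩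
        {ω | 0 < (inner ℝ (latticePoint (X (k₀ + i) ω)) ℓ : ℝ)}).indicator (fun _ => ν i) ω
          - t ^ (1 / 2 + ε)}
      ≤ Real.exp (-(t ^ (2 * ε) / (4 * K ^ 2))) := by
  have : IsProbabilityMeasure P[|G] := cond_isProbabilityMeasure hPG
  have hGm : MeasurableSet G := ℱ.le _ _ hG
  have hSm : ∀ n, MeasurableSet[ℱ (k₀ + n)] (newSite X k₀ n ∩
      {ω | 0 < (inner ℝ (latticePoint (X (k₀ + n) ω)) ℓ : ℝ)}) := fun n =>
    (H.measurableSet_newSite k₀ n).inter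
      (H.measurable_inner_latticePoint (k₀ + n) measurableSet_Ioi)
  refine measureReal_sum_le_sub_rpow_le (𝒢 := shiftFiltration ℱ k₀)
    (ξ := fun n ω => inner ℝ (increment X (k₀ + n) ω) ℓ)
    (v := fun n => (newSite X k₀ n ∩
        {ω | 0 < (inner ℝ (latticePoint (X (k₀ + n) ω)) ℓ : ℝ)}).indicator (fun _ => ν n))
    (b := ν) (fun n => H.measurable_inner_increment (k₀ + n) ℓ)
    (fun n => measurable_const.indicator (hSm n))
    (fun n ω => H.abs_inner_increment_le (k₀ + n) ω)
    (fun n ω => Set.indicator_nonneg (fun _ _ => hν0 n) ω)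
    (fun n ω => Set.indicator_le_self' (fun _ _ => hν0 n) ω) ?_ H.K_pos ht htK hn
  rintro n W hWm hW0 ⟨c, hWc⟩
  have hWm' : Measurable[ℱ (k₀ + n)] W := hWm
  have hGn : MeasurableSet[ℱ (k₀ + n)] G := ℱ.mono (Nat.le_add_right k₀ n) _ hG
  rw [integral_cond_eq, integral_cond_eq]
  refine mul_le_mul_of_nonneg_left ?_ (inv_nonneg.2 measureReal_nonneg)
  rw [← integral_indicator hGm, ← integral_indicator hGm]
  -- The indicator of the past event `G` is absorbed into the test function, so the unconditioned
  -- drift inequality gives the conditioned one.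
  have h1 := H.integral_mul_le_integral_mul_increment hA (hν n) (W := G.indicator W)
    (hWm'.indicator hGn) (fun ω => Set.indicator_nonneg (fun _ _ => hW0 _) ω) (b := c)
    (fun ω => (Set.indicator_le_self' (fun _ _ => hW0 _) ω).trans (hWc ω))
  have h2 : ∀ (f : Ω → ℝ) ω, G.indicator (fun ω => W ω * f ω) ω = G.indicator W ω * f ω :=
    fun f ω => Set.indicator_mul_left G W f
  simp only [h2]
  exact h1

/-- Transience with positive probability, given summable bounds on the probabilities of large
fluctuations and of small numbers of new sites. -/
theorem measure_tendsto_pos_of_bounds (H : IsGERW P ℱ lam ℓ A K h r X) {k₀ κ : ℕ} {G : Set Ω}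
    (hG : G = {ω | ∀ i < k₀, r < inner ℝ (increment X i ω) ℓ})
    {ν : ℕ → ℝ} (hν0 : ∀ i, 0 ≤ ν i) (hν : Antitone ν) {a e : ℝ} (he : 0 < e)
    (hL : 2 * ((2 : ℝ) ^ κ) ^ e ≤ r * k₀)
    (hgain : ∀ k, κ ≤ k → 2 * ((2 : ℝ) ^ (k + 1)) ^ e ≤ ν (2 ^ k) * ((2 : ℝ) ^ k) ^ a)
    {p q : ℕ → ℝ} (hp : Summable p) (hq : Summable q) (hpq : ∑' k, p k + ∑' j, q j < 1)
    (hcount : ∀ k, P[|G].real {ω | occurrences (newSite X k₀) (2 ^ (κ + k)) ω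
      ≤ ((2 : ℝ) ^ (κ + k)) ^ a} ≤ p k)
    (hfluct : ∀ j : ℕ, P[|G].real {ω | ∑ i ∈ Finset.range j, inner ℝ (increment X (k₀ + i) ω) ℓ
      ≤ ∑ i ∈ Finset.range j, (newSite X k₀ i ∩
        {ω | 0 < (inner ℝ (latticePoint (X (k₀ + i) ω)) ℓ : ℝ)}).indicator (fun _ => ν i) ω
          - (max (j : ℝ) (2 ^ κ)) ^ e} ≤ q j) :
    0 < P {ω | Tendsto (fun n => inner ℝ (latticePoint (X n ω)) ℓ) atTop atTop} := by
  classical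
  have hGm : MeasurableSet G := by rw [hG]; exact ℱ.le _ _ (H.measurableSet_forall_jump k₀)
  have hPG : P G ≠ 0 := by
    have := H.measureReal_forall_jump_pos k₀
    rw [← hG] at this
    intro h0
    rw [measureReal_def, h0] at this
    simp at this
  have : IsProbabilityMeasure P[|G] := cond_isProbabilityMeasure hPG
  set good := {ω | Tendsto (fun n => (inner ℝ (latticePoint (X n ω)) ℓ : ℝ)) atTop atTop}
  have h1 := measure_iUnion_le_ofReal_tsum hcount hp
  have h2 := measure_iUnion_le_ofReal_tsum hfluct hq
  set bad₁ := ⋃ k, {ω | occurrences (newSite X k₀) (2 ^ (κ + k)) ω ≤ ((2 : ℝ) ^ (κ + k)) ^ a}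
  set bad₂ := ⋃ j : ℕ, {ω | ∑ i ∈ Finset.range j, inner ℝ (increment X (k₀ + i) ω) ℓ
      ≤ ∑ i ∈ Finset.range j, (newSite X k₀ i ∩
        {ω | 0 < (inner ℝ (latticePoint (X (k₀ + i) ω)) ℓ : ℝ)}).indicator (fun _ => ν i) ω
          - (max (j : ℝ) (2 ^ κ)) ^ e}
  have hsub : G ⊆ good ∪ (bad₁ ∪ bad₂) := by
    intro ω hωG
    by_contra hω
    simp only [Set.mem_union, not_or] at hω
    obtain ⟨hω1, hω2, hω3⟩ := hω
    refine hω1 ?_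
    simp only [bad₁, bad₂, Set.mem_iUnion, Set.mem_ofPred_eq, not_exists, not_le] at hω2 hω3
    have hS0 : r * k₀ ≤ inner ℝ (latticePoint (X k₀ ω)) ℓ := by
      rw [hG] at hωG
      exact H.mul_le_inner_of_forall_jump hωG
    have key : Tendsto (fun n => (inner ℝ (latticePoint (X (k₀ + n) ω)) ℓ : ℝ)) atTop atTop := by
      refine tendsto_atTop_of_dyadic_bounds (N := fun i => ω ∈ newSite X k₀ i) (κ := κ) (a := a)
        he hν hν0 (hL.trans hS0) (fun j => ?_) (fun k hk => ?_) hgain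
      · have h3 := (hω3 j).le
        have h4 : ∑ i ∈ Finset.range j, (inner ℝ (increment X (k₀ + i) ω) ℓ : ℝ)
            = inner ℝ (latticePoint (X (k₀ + j) ω)) ℓ
              - inner ℝ (latticePoint (X (k₀ + 0) ω)) ℓ := by
          rw [← Finset.sum_range_sub (fun i => (inner ℝ (latticePoint (X (k₀ + i) ω)) ℓ : ℝ))]
          exact Finset.sum_congr rfl fun i _ => by rw [increment, inner_sub_left]; rfl
        rw [h4] at h3
        simpa only [Set.indicator_apply, Set.mem_inter_iff, Set.mem_ofPred_eq] using h3
      · obtain ⟨k', rfl⟩ := Nat.exists_eq_add_of_le hk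
        have h3 := (hω2 k').le
        simpa only [occurrences, Set.indicator_apply] using h3
    have h5 : (fun n => (inner ℝ (latticePoint (X (k₀ + n) ω)) ℓ : ℝ))
        = fun n => inner ℝ (latticePoint (X (n + k₀) ω)) ℓ := by
      ext n; rw [add_comm]
    rw [h5] at key
    exact (tendsto_add_atTop_iff_nat (f := fun n => (inner ℝ (latticePoint (X n ω)) ℓ : ℝ))
      k₀).1 key
  -- If convergence to infinity had probability zero, the two bad events would cover almost all of
  -- `G`, although their conditional probabilities sum to less than one.
  by_contra hneg
  have hgood : P[|G] good = 0 := cond_absolutelyContinuous (nonpos_iff_eq_zero.1 (not_lt.1 hneg))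
  have hone : P[|G] G = 1 := by
    rw [cond_apply hGm, Set.inter_self, ENNReal.inv_mul_cancel hPG (measure_ne_top P G)]
  have h6 : (1 : ENNReal) ≤ ENNReal.ofReal (∑' k, p k + ∑' j, q j) := by
    calc (1 : ENNReal) = P[|G] G := hone.symm
      _ ≤ P[|G] good + (P[|G] bad₁ + P[|G] bad₂) :=
        (measure_mono hsub).trans ((measure_union_le _ _).trans
          (add_le_add_right (measure_union_le _ _) _))
      _ ≤ ENNReal.ofReal (∑' k, p k) + ENNReal.ofReal (∑' j, q j) := by
        rw [hgood, zero_add]; exact add_le_add h1 h2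
      _ = _ := by
        rw [ENNReal.ofReal_add (tsum_nonneg fun k => measureReal_nonneg.trans (hcount k))
          (tsum_nonneg fun k => measureReal_nonneg.trans (hfluct k))]
  have h7 : ENNReal.ofReal (∑' k, p k + ∑' j, q j) < 1 := by
    rw [ENNReal.ofReal_lt_one]; exact hpq
  exact absurd h6 (not_le.2 h7)

end IsGERW

/-! ### Choice of the initial scale and conclusion. -/

theorem eventually_exp_neg_rpow_le {s c : ℝ} (hs : 0 < s) (hc : 0 < c) :
    ∀ᶠ t : ℝ in atTop, Real.exp (-(t ^ s / c)) ≤ t ^ (-3 : ℝ) := by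
  have h1 := (tendsto_rpow_mul_exp_neg_mul_atTop_nhds_zero (3 / s) (1 / c) (by positivity)).comp
    (tendsto_rpow_atTop hs)
  filter_upwards [h1.eventually (gt_mem_nhds one_pos), eventually_gt_atTop 0] with t ht ht0
  simp only [Function.comp_apply] at ht
  rw [← Real.rpow_mul ht0.le, mul_div_cancel₀ _ hs.ne'] at ht
  have h2 : -(1 / c) * t ^ s = -(t ^ s / c) := by ring
  rw [h2] at ht
  have h3 : t ^ (-3 : ℝ) = (t ^ (3 : ℝ))⁻¹ := Real.rpow_neg ht0.le 3
  rw [h3, ← one_div, le_div_iff₀ (Real.rpow_pos_of_pos ht0 _), mul_comm]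
  exact ht.le

/-- The drift gained by time `t` is of order `t ^ (1 / 2 + α / 2)`, against fluctuations `t ^ (1 / 2
+ α / 4)`; the surplus `t ^ (α / 4)` pays for all the constants. -/
theorem gain_le {α lam₀ t s x : ℝ} (hα : 0 < α) (hα1 : α ≤ 1 / 64) (hlam : 0 < lam₀) (ht : 1 ≤ t)
    (hs0 : 0 < s) (hs : s ≤ 3 * t) (hx : x = 2 * t) (h12 : 12 / lam₀ ≤ t ^ (α / 4)) :
    2 * x ^ (1 / 2 + α / 4) ≤ lam₀ * s ^ (-(α / 2)) * t ^ (1 / 2 + α) := by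
  have ht0 : 0 < t := by linarith
  have h1 : x ^ (1 / 2 + α / 4) ≤ 2 * t ^ (1 / 2 + α / 4) := by
    rw [hx, Real.mul_rpow (by norm_num) ht0.le]
    refine mul_le_mul_of_nonneg_right ?_ (Real.rpow_nonneg ht0.le _)
    calc (2 : ℝ) ^ (1 / 2 + α / 4) ≤ 2 ^ (1 : ℝ) :=
          Real.rpow_le_rpow_of_exponent_le (by norm_num) (by linarith)
      _ = 2 := Real.rpow_one 2
  have h2 : t ^ (-(α / 2)) / 3 ≤ s ^ (-(α / 2)) := by
    calc t ^ (-(α / 2)) / 3 = 3 ^ (-1 : ℝ) * t ^ (-(α / 2)) := by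
          rw [Real.rpow_neg_one]; ring
      _ ≤ 3 ^ (-(α / 2)) * t ^ (-(α / 2)) := by
          refine mul_le_mul_of_nonneg_right ?_ (Real.rpow_nonneg ht0.le _)
          exact Real.rpow_le_rpow_of_exponent_le (by norm_num) (by linarith)
      _ = (3 * t) ^ (-(α / 2)) := (Real.mul_rpow (by norm_num) ht0.le).symm
      _ ≤ _ := Real.rpow_le_rpow_of_nonpos hs0 hs (by linarith)
  have h3 : t ^ (-(α / 2)) * t ^ (1 / 2 + α) = t ^ (α / 4) * t ^ (1 / 2 + α / 4) := by
    rw [← Real.rpow_add ht0, ← Real.rpow_add ht0]; ring_nf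
  have hp : 0 < t ^ (1 / 2 + α / 4) := Real.rpow_pos_of_pos ht0 _
  rw [div_le_iff₀ hlam] at h12
  calc 2 * x ^ (1 / 2 + α / 4) ≤ 12 * t ^ (1 / 2 + α / 4) / 3 := by linarith
    _ ≤ t ^ (α / 4) * lam₀ * t ^ (1 / 2 + α / 4) / 3 := by gcongr
    _ = lam₀ * (t ^ (-(α / 2)) / 3) * t ^ (1 / 2 + α) := by
        linear_combination (-(lam₀ / 3)) * h3
    _ ≤ _ := by gcongr

/-- Of the three powers in `t ^ (-3)`, two make the bound summable in `j`, since `j + 1 ≤ 2 * t`,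
and one supplies the factor `1 / T` that makes the whole sum small. -/
theorem exp_bound_le_div_sq {f : ℝ → ℝ} {T : ℝ} (hT : 1 ≤ T)
    (hf : ∀ t, T ≤ t → f t ≤ t ^ (-3 : ℝ)) (j : ℕ) :
    f (max j T) ≤ 4 / T * (1 / ((j : ℝ) + 1) ^ 2) := by
  have hj : (0 : ℝ) ≤ j := Nat.cast_nonneg j
  set t := max (j : ℝ) T with ht
  have h1 : T ≤ t := le_max_right _ _
  have h2 : (j : ℝ) ≤ t := le_max_left _ _
  have ht0 : 0 < t := by linarith
  have h3 : t ^ (-3 : ℝ) = 1 / (t * t ^ 2) := by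
    rw [Real.rpow_neg ht0.le, ← one_div]
    congr 1
    rw [show (3 : ℝ) = ((3 : ℕ) : ℝ) by norm_num, Real.rpow_natCast]; ring
  refine (hf t h1).trans ?_
  rw [h3, div_mul_div_comm, div_le_div_iff₀ (by positivity) (by positivity)]
  have h4 : ((j : ℝ) + 1) ^ 2 ≤ 4 * t ^ 2 := by nlinarith
  have h5 : T * ((j : ℝ) + 1) ^ 2 ≤ t * (4 * t ^ 2) :=
    mul_le_mul h1 h4 (by positivity) ht0.le
  linarith

theorem eventually_scale_large {α γ C K r lam₀ Z : ℝ} (n₀ n₁ : ℕ) (hα : 0 < α) (hα1 : α ≤ 1 / 64)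
    (hγ : 0 < γ) (hK : 0 < K) :
    ∀ᶠ T : ℝ in atTop, 1 ≤ T ∧ (n₀ : ℝ) ≤ T ∧ (n₁ : ℝ) ≤ T ∧ 2 / r + 1 ≤ T ^ (3 * α / 4) ∧
      12 / lam₀ ≤ T ^ (α / 4) ∧ T ^ (α / 4 - 1 / 2) ≤ 2 * K ∧
      (∀ t, T ≤ t → Real.exp (-(t ^ (2 * (α / 4)) / (4 * K ^ 2))) ≤ t ^ (-3 : ℝ)) ∧
      C * T ^ (-γ) + 4 / T * Z < 1 := by
  have h1 : ∀ᶠ T : ℝ in atTop, T ^ (α / 4 - 1 / 2) ≤ 2 * K := by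
    have := tendsto_rpow_neg_atTop (y := 1 / 2 - α / 4) (by linarith)
    rw [neg_sub] at this
    filter_upwards [this.eventually (gt_mem_nhds (by positivity : 0 < 2 * K))] with T hT using hT.le
  have h2 : ∀ᶠ T : ℝ in atTop, C * T ^ (-γ) + 4 / T * Z < 1 := by
    have h3 : Tendsto (fun T : ℝ => C * T ^ (-γ) + 4 / T * Z) atTop (nhds (C * 0 + 0 * Z)) :=
      ((tendsto_rpow_neg_atTop hγ).const_mul C).add
        ((tendsto_const_nhds.div_atTop tendsto_id).mul_const Z)
    exact h3.eventually (gt_mem_nhds (by norm_num))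
  filter_upwards [eventually_ge_atTop 1, eventually_ge_atTop (n₀ : ℝ),
    eventually_ge_atTop (n₁ : ℝ),
    (tendsto_rpow_atTop (by positivity : 0 < 3 * α / 4)).eventually_ge_atTop (2 / r + 1),
    (tendsto_rpow_atTop (by positivity : 0 < α / 4)).eventually_ge_atTop (12 / lam₀), h1,
    eventually_forall_ge_atTop.2 (eventually_exp_neg_rpow_le (by positivity : 0 < 2 * (α / 4))
      (by positivity : 0 < 4 * K ^ 2)), h2]
    with T a1 a2 a3 a4 a5 a6 a7 a8
  exact ⟨a1, a2, a3, a4, a5, a6, a7, a8⟩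

theorem theorem1 (d : ℕ) (hd : 2 ≤ d) (K h r : ℝ) (hK : 0 < K) (hh : 0 < h) (hr : 0 < r) :
    ∃ β₀ : ℝ, 0 < β₀ ∧ β₀ < 1 / 6 ∧
      ∀ (Ω : Type*) [mΩ : MeasurableSpace Ω] (P : Measure Ω) [IsProbabilityMeasure P]
        (ℱ : Filtration ℕ mΩ)
        (lam : ℕ → ℝ) (ℓ : EuclideanSpace ℝ (Fin d)) (A : Set (Fin d → ℤ))
        (X : ℕ → Ω → (Fin d → ℤ)),
        IsGERW P ℱ lam ℓ A K h r X → positiveHalfSpace ℓ ⊆ A →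
        ∀ (n₀ : ℕ) (lam₀ β : ℝ), 0 < lam₀ → β < β₀ →
          (∀ n : ℕ, 1 ≤ n → lam₀ * ((n₀ : ℝ) + (n : ℝ)) ^ (-β) ≤ lam n) →
          0 < P {ω | Tendsto (fun n => inner ℝ (latticePoint (X n ω)) ℓ) atTop atTop} := by
  obtain ⟨α, γ, C, n₁, hα, hα1, hγ, hC, hocc⟩ := exists_occurrences_bound d hd K h r hK hh hr
  refine ⟨α / 2, by positivity, by linarith, ?_⟩
  intro Ω mΩ P _ ℱ lam ℓ A X H hA n₀ lam₀ β hlam₀ hβ hlam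
  have hg0 : 0 < (2 : ℝ) ^ (-γ) := by positivity
  have hg1 : (2 : ℝ) ^ (-γ) < 1 := Real.rpow_lt_one_of_one_lt_of_neg (by norm_num) (by linarith)
  have hZ : Summable fun j : ℕ => 1 / ((j : ℝ) + 1) ^ 2 := by
    have := (summable_nat_add_iff 1).2 (Real.summable_one_div_nat_pow.2 (by norm_num : 1 < 2))
    simpa using this
  obtain ⟨κ, hκ⟩ := ((tendsto_pow_atTop_atTop_of_one_lt (by norm_num : (1 : ℝ) < 2)).eventually
    (eventually_scale_large (C := C * (1 - (2 : ℝ) ^ (-γ))⁻¹) (r := r) (lam₀ := lam₀)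
      (Z := ∑' j : ℕ, 1 / ((j : ℝ) + 1) ^ 2) n₀ n₁ hα hα1 hγ hK)).exists
  set T : ℝ := 2 ^ κ with hT
  obtain ⟨hT1, hTn₀, hTn₁, hTr, hTlam, hTK, hTexp, hTsum⟩ := hκ
  have hT0 : 0 < T := by linarith
  set e := 1 / 2 + α / 4 with he
  -- The initial run must reach height `2 * T ^ e`, yet stay below `T ^ (1 / 2 + α)` steps so that
  -- the sites it visits do not spoil the count of new ones. Both are possible because `e = 1 / 2 +
  -- α / 4` is smaller than `1 / 2 + α`.
  set k₀ := ⌈2 * T ^ e / r⌉₊ with hk₀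
  have hTe : 1 ≤ T ^ e := Real.one_le_rpow hT1 (by positivity)
  have hk₀1 : 1 ≤ k₀ := Nat.one_le_iff_ne_zero.2 (Nat.ceil_pos.2 (by positivity)).ne'
  have hL : 2 * T ^ e ≤ r * k₀ := by
    have := Nat.le_ceil (2 * T ^ e / r)
    rw [div_le_iff₀ hr] at this
    linarith
  have hk₀a : (k₀ : ℝ) ≤ T ^ (1 / 2 + α) := by
    have h1 : (k₀ : ℝ) ≤ 2 * T ^ e / r + 1 := (Nat.ceil_lt_add_one (by positivity)).le
    have h2 : T ^ (1 / 2 + α) = T ^ (3 * α / 4) * T ^ e := by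
      rw [← Real.rpow_add hT0, he]; ring_nf
    rw [h2]
    have h3 := mul_le_mul_of_nonneg_right hTr (by linarith : 0 ≤ T ^ e)
    have h4 : (2 / r + 1) * T ^ e = 2 * T ^ e / r + T ^ e := by ring
    linarith
  -- Together with `n₀ ≤ T`, this gives `n₀ + k₀ + 2 ^ k ≤ 3 * 2 ^ k` for `k ≥ κ`, as `gain_le`
  -- requires.
  have hk₀T : (k₀ : ℝ) ≤ T := hk₀a.trans (by
    calc T ^ (1 / 2 + α) ≤ T ^ (1 : ℝ) := Real.rpow_le_rpow_of_exponent_le hT1 (by linarith)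
      _ = T := Real.rpow_one T)
  set G := {ω | ∀ i < k₀, r < inner ℝ (increment X i ω) ℓ} with hG
  have hGm : MeasurableSet[ℱ k₀] G := H.measurableSet_forall_jump k₀
  have hPG : P G ≠ 0 := by
    have := H.measureReal_forall_jump_pos k₀
    intro h0
    rw [← hG, measureReal_def, h0] at this
    simp at this
  have : IsProbabilityMeasure P[|G] := cond_isProbabilityMeasure hPG
  -- Replacing `β` by the larger exponent `α / 2` only lowers the bound, as the base is at least
  -- `1`, and makes it antitone even when `β` is negative.
  set ν : ℕ → ℝ := fun i => lam₀ * ((n₀ : ℝ) + (k₀ + i)) ^ (-(α / 2)) with hνdef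
  have hk₀R : (1 : ℝ) ≤ k₀ := by exact_mod_cast hk₀1
  have hbase : ∀ i : ℕ, (1 : ℝ) ≤ (n₀ : ℝ) + (k₀ + i) := fun i => by
    have h1 : (0 : ℝ) ≤ n₀ := Nat.cast_nonneg _
    have h2 : (0 : ℝ) ≤ i := Nat.cast_nonneg _
    linarith
  have hν0 : ∀ i, 0 ≤ ν i := fun i =>
    mul_nonneg hlam₀.le (Real.rpow_nonneg (by linarith [hbase i]) _)
  have hνanti : Antitone ν := fun i j hij => by
    refine mul_le_mul_of_nonneg_left ?_ hlam₀.le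
    refine Real.rpow_le_rpow_of_nonpos (by linarith [hbase i]) ?_ (by linarith)
    have : (i : ℝ) ≤ j := by exact_mod_cast hij
    linarith
  have hνlam : ∀ i, ν i ≤ lam (k₀ + i) := fun i => by
    refine le_trans ?_ (hlam (k₀ + i) (by omega))
    push_cast
    exact mul_le_mul_of_nonneg_left
      (Real.rpow_le_rpow_of_exponent_le (hbase i) (by linarith)) hlam₀.le
  have hpow : ∀ k, κ ≤ k → T ≤ (2 : ℝ) ^ k := fun k hk =>
    pow_le_pow_right₀ (by norm_num) hk
  have hgeom := summable_geometric_of_lt_one hg0.le hg1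
  refine H.measure_tendsto_pos_of_bounds (k₀ := k₀) (κ := κ) hG hν0 hνanti (a := 1 / 2 + α)
    (e := e) (by positivity) hL ?_ (p := fun k => C * T ^ (-γ) * ((2 : ℝ) ^ (-γ)) ^ k)
    (q := fun j => 4 / T * (1 / ((j : ℝ) + 1) ^ 2)) (hgeom.mul_left _) (hZ.mul_left _) ?_ ?_ ?_
  · intro k hk
    have h1 := hpow k hk
    refine gain_le hα hα1 hlam₀ (hT1.trans h1) (by push_cast; linarith [hbase (2 ^ k)]) ?_
      (pow_succ' 2 k) (hTlam.trans (Real.rpow_le_rpow hT0.le h1 (by positivity)))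
    push_cast; linarith
  · rw [tsum_mul_left, tsum_mul_left, tsum_geometric_of_lt_one hg0.le hg1]
    calc _ = C * (1 - (2 : ℝ) ^ (-γ))⁻¹ * T ^ (-γ)
          + 4 / T * ∑' j : ℕ, 1 / ((j : ℝ) + 1) ^ 2 := by ring
      _ < 1 := hTsum
  · intro k
    have h1 := hpow (κ + k) (Nat.le_add_right κ k)
    have h2 := hocc Ω mΩ P[|G] (shiftFiltration ℱ k₀) (newSite X k₀) (fun n => X (k₀ + n))
      (H.isCenteredOff hGm) k₀ (2 ^ (κ + k)) (card_image_range_le_occurrences X k₀ _)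
      (by
        have : (n₁ : ℝ) ≤ ((2 ^ (κ + k) : ℕ) : ℝ) := by push_cast; linarith
        exact_mod_cast this)
      (by
        push_cast
        exact hk₀a.trans (Real.rpow_le_rpow hT0.le h1 (by positivity)))
    push_cast at h2
    refine h2.trans (le_of_eq ?_)
    rw [pow_add, Real.mul_rpow hT0.le (by positivity), ← Real.rpow_natCast 2 k,
      ← Real.rpow_mul (by norm_num), ← Real.rpow_natCast (2 ^ (-γ)) k,
      ← Real.rpow_mul (by norm_num), mul_comm (k : ℝ)]
    ring
  · intro j
    have hmax : 0 < max (j : ℝ) T := lt_max_of_lt_right hT0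
    have h1 := H.measureReal_cond_fluctuation_le hA hGm hPG hν0 hνlam (ε := α / 4) (n := j) hmax
      (le_trans (Real.rpow_le_rpow_of_nonpos hT0 (le_max_right _ _) (by linarith)) hTK)
      (le_max_left _ _)
    exact h1.trans (exp_bound_le_div_sq
      (f := fun t => Real.exp (-(t ^ (2 * (α / 4)) / (4 * K ^ 2)))) hT1 hTexp j)
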